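/- Let $\mathcal X,\mathcal Y$ be compact smooth Riemannian manifolds without boundary, of dimensions $d_x,d_y$, with their geodesic distances $d$ and Riemannian volume measures $\mathrm{vol}$. Let $\ell:\mathcal X\times\mathcal Y\to\mathbb R$ be continuously differentiable, and put $\mathcal L(\mu_x,\mu_y)=\iint \ell\,d\mu_x\,d\mu_y$, $V_x(\mu_y,x)=\int\ell(x,y)\,d\mu_y(y)$, $V_y(\mu_x,y)=\int\ell(x,y)\,d\mu_x(x)$ and $$\mathrm{NI}(\mu_x,\mu_y)=\sup_{\mu_y'\in\mathcal P(\mathcal Y)}\mathcal L(\mu_x,\mu_y')-\inf_{\mu_x'\in\mathcal P(\mathcal X)}\mathcal L(\mu_x',\mu_y),\qquad B=\tfrac12(\max\ell-\min\ell)+\mathrm{Lip}(\ell),$$ where $\mathrm{Lip}(\ell)$ is the Lipschitz constant of $\ell$ for the distance $d(x,x')+d(y,y')$. For $\alpha,\gamma>0$ let $(\nu_x(t),\nu_y(t))_{t\ge0}$ be Borel probability measures that solve, weakly against $C^1$ test functions, the interacting Wasserstein–Fisher–Rao gradient flow $$\begin{cases}\partial_t\nu_x=\gamma\,\nabla_x\!\cdot(\nu_x\nabla_xV_x(\nu_y,x))-\alpha\,\nu_x\,(V_x(\nu_y,x)-\mathcal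 L(\nu_x,\nu_y)),\\ \partial_t\nu_y=-\gamma\,\nabla_y\!\cdot(\nu_y\nabla_yV_y(\nu_x,y))+\alpha\,\nu_y\,(V_y(\nu_x,y)-\mathcal L(\nu_x,\nu_y)),\end{cases}$$ and let $\bar\nu_x(t)=\frac1t\int_0^t\nu_x(s)\,ds$, $\bar\nu_y(t)=\frac1t\int_0^t\nu_y(s)\,ds$. Suppose that $\nu_x(0),\nu_y(0)$ are absolutely continuous with respect to $\mathrm{vol}$ with densities bounded below almost everywhere by $e^{-K_x'}$, $e^{-K_y'}$ respectively. There is a real $K_x$ with $\mathrm{vol}(B(x,r))\ge e^{-K_x}r^{d_x}$ for all $x\in\mathcal X$ and $r\in(0,1]$, and likewise a $K_y$ for $\mathcal Y$. For every $\delta\in(0,1/2)$ there is a constant $C>0$, depending only on $\delta$, the dimensions $d_x,d_y$, such ball-volume constants $K_x,K_y$, on $K_x',K_y'$ and on $B$, such that for every $\varepsilon>0$, if $$\frac\gamma\alpha<1\quad\text{and}\quad\frac\gamma\alpha\le\left(\frac{\varepsilon}{C}\right)^{\frac{2}{1-\delta}},$$ then $\mathrm{NI}(\bar\nu_x(t_0),\bar\nu_y(t_0))\le\varepsilon$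 at $t_0=(\alpha\gamma)^{-1/2}$. -/

import Mathlib

open Bundle MeasureTheory Set
open scoped Manifold ContDiff ENNReal NNReal

noncomputable section

/-- The Riemannian gradient at `x` of a real function `f` on a finite-dimensional Riemannian
manifold: the Riesz representative of the differential of `f` at `x` for the Riemannian inner
product on the tangent space. -/
def riemannianGrad (d : ℕ) {M : Type*} [TopologicalSpace M]
    [ChartedSpace (EuclideanSpace ℝ (Fin d)) M]
    [RiemannianBundle (fun x : M ↦ TangentSpace (𝓡 d) x)]
    (f : M → ℝ) (x : M) : TangentSpace (𝓡 d) x :=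
  haveI : FiniteDimensional ℝ (TangentSpace (𝓡 d) x) :=
    inferInstanceAs (FiniteDimensional ℝ (EuclideanSpace ℝ (Fin d)))
  haveI : CompleteSpace (TangentSpace (𝓡 d) x) :=
    FiniteDimensional.complete ℝ (TangentSpace (𝓡 d) x)
  (InnerProductSpace.toDual ℝ (TangentSpace (𝓡 d) x)).symm (mfderiv (𝓡 d) 𝓘(ℝ, ℝ) f x)

theorem inner_riemannianGrad (d : ℕ) {M : Type*} [TopologicalSpace M]
    [ChartedSpace (EuclideanSpace ℝ (Fin d)) M]
    [RiemannianBundle (fun x : M ↦ TangentSpace (𝓡 d) x)]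
    (f : M → ℝ) (x : M) (v : TangentSpace (𝓡 d) x) :
    inner ℝ (riemannianGrad d f x) v = mfderiv (𝓡 d) 𝓘(ℝ, ℝ) f x v := by
  have : FiniteDimensional ℝ (TangentSpace (𝓡 d) x) :=
    inferInstanceAs (FiniteDimensional ℝ (EuclideanSpace ℝ (Fin d)))
  have : CompleteSpace (TangentSpace (𝓡 d) x) :=
    FiniteDimensional.complete ℝ (TangentSpace (𝓡 d) x)
  exact InnerProductSpace.toDual_symm_apply

/-- The volume measure of a `d`-dimensional Riemannian manifold: the `d`-dimensional Hausdorff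
measure of its Riemannian distance, normalized to be Lebesgue measure on `ℝ^d`. -/
def riemannianVolume (d : ℕ) (M : Type*) [EMetricSpace M] [MeasurableSpace M] [BorelSpace M] :
    Measure M :=
  Measure.euclideanHausdorffMeasure d

/-- `K` is a ball-volume constant of the `d`-dimensional manifold `M`: every geodesic ball of radius
`r ∈ (0, 1]` has volume at least `e^{-K} r^d`. -/
def IsBallVolumeConst (d : ℕ) (M : Type*) [EMetricSpace M] [MeasurableSpace M] [BorelSpace M]
    (K : ℝ) : Prop :=
  ∀ (x : M) (r : ℝ), 0 < r → r ≤ 1 →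
    ENNReal.ofReal (Real.exp (-K) * r ^ d) ≤
      riemannianVolume d M (Metric.eball x (ENNReal.ofReal r))

/-- `ν` is absolutely continuous for the volume measure, with density at least `e^{-K}`. -/
def DensityLowerBound (d : ℕ) {M : Type*} [EMetricSpace M] [MeasurableSpace M] [BorelSpace M]
    (ν : Measure M) (K : ℝ) : Prop :=
  ν ≪ riemannianVolume d M ∧
    ∀ᵐ x ∂(riemannianVolume d M), ENNReal.ofReal (Real.exp (-K)) ≤ ν.rnDeriv (riemannianVolume d M) x

section Game

variable {X Y : Type*}

/-- The expected loss `∬ ℓ(x, y) dμ(x) dν(y)`. -/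
def expectedLoss [MeasurableSpace X] [MeasurableSpace Y] (ℓ : X → Y → ℝ)
    (μ : Measure X) (ν : Measure Y) : ℝ :=
  ∫ x, ∫ y, ℓ x y ∂ν ∂μ

/-- The first variation of the expected loss in the first player's measure. -/
def firstVarX [MeasurableSpace Y] (ℓ : X → Y → ℝ) (ν : Measure Y) (x : X) : ℝ :=
  ∫ y, ℓ x y ∂ν

/-- The first variation of the expected loss in the second player's measure. -/
def firstVarY [MeasurableSpace X] (ℓ : X → Y → ℝ) (μ : Measure X) (y : Y) : ℝ :=
  ∫ x, ℓ x y ∂μ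

/-- The Nikaido–Isoda error. -/
def nikaidoIsoda [MeasurableSpace X] [MeasurableSpace Y] (ℓ : X → Y → ℝ)
    (μ : Measure X) (ν : Measure Y) : ℝ :=
  (⨆ ν' : ProbabilityMeasure Y, expectedLoss ℓ μ (ν' : Measure Y)) -
    ⨅ μ' : ProbabilityMeasure X, expectedLoss ℓ (μ' : Measure X) ν

/-- The time average `(1/t) ∫₀ᵗ ν(s) ds` of a curve of probability measures. -/
def timeAverage [MeasurableSpace X] (ν : ℝ → ProbabilityMeasure X) (t : ℝ) : Measure X :=
  ENNReal.ofReal t⁻¹ • (volume.restrict (Ioc 0 t)).bind (fun s ↦ (ν s : Measure X))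

/-- The best Lipschitz constant of `ℓ`, for the distance `d(x, x') + d(y, y')`. -/
def lossLip [EMetricSpace X] [EMetricSpace Y] (ℓ : X → Y → ℝ) : ℝ≥0 :=
  sInf {Λ : ℝ≥0 | ∀ x x' y y', edist (ℓ x y) (ℓ x' y') ≤ Λ * (edist x x' + edist y y')}

/-- `B = (max ℓ - min ℓ) / 2 + Lip(ℓ)`. -/
def lossConst [EMetricSpace X] [EMetricSpace Y] (ℓ : X → Y → ℝ) : ℝ :=
  ((⨆ p : X × Y, ℓ p.1 p.2) - ⨅ p : X × Y, ℓ p.1 p.2) / 2 + lossLip ℓ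

/-- `(νx, νy)` solves on `[0, ∞)`, in the weak sense (against `C^1` test functions), the interacting
Wasserstein–Fisher–Rao gradient flow
`∂ₜ νx =  γ ∇·(νx ∇Vx(νy, ·)) - α νx (Vx(νy, ·) - L(νx, νy))`,
`∂ₜ νy = -γ ∇·(νy ∇Vy(νx, ·)) + α νy (Vy(νx, ·) - L(νx, νy))`. -/
structure IsWFRFlow (dx dy : ℕ)
    [TopologicalSpace X] [ChartedSpace (EuclideanSpace ℝ (Fin dx)) X]
    [RiemannianBundle (fun x : X ↦ TangentSpace (𝓡 dx) x)] [MeasurableSpace X]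
    [TopologicalSpace Y] [ChartedSpace (EuclideanSpace ℝ (Fin dy)) Y]
    [RiemannianBundle (fun y : Y ↦ TangentSpace (𝓡 dy) y)] [MeasurableSpace Y]
    (α γ : ℝ) (ℓ : X → Y → ℝ)
    (νx : ℝ → ProbabilityMeasure X) (νy : ℝ → ProbabilityMeasure Y) : Prop where
  eq_x : ∀ φ : X → ℝ, ContMDiff (𝓡 dx) 𝓘(ℝ, ℝ) 1 φ → ∀ t, 0 ≤ t →
    HasDerivWithinAt (fun s ↦ ∫ x, φ x ∂(νx s : Measure X))
      (-γ * (∫ x, inner ℝ (riemannianGrad dx φ x)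
            (riemannianGrad dx (firstVarX ℓ (νy t : Measure Y)) x) ∂(νx t : Measure X))
        - α * ∫ x, φ x * (firstVarX ℓ (νy t : Measure Y) x
            - expectedLoss ℓ (νx t : Measure X) (νy t : Measure Y)) ∂(νx t : Measure X))
      (Ici 0) t
  eq_y : ∀ φ : Y → ℝ, ContMDiff (𝓡 dy) 𝓘(ℝ, ℝ) 1 φ → ∀ t, 0 ≤ t →
    HasDerivWithinAt (fun s ↦ ∫ y, φ y ∂(νy s : Measure Y))
      (γ * (∫ y, inner ℝ (riemannianGrad dy φ y)
            (riemannianGrad dy (firstVarY ℓ (νx t : Measure X)) y) ∂(νy t : Measure Y))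
        + α * ∫ y, φ y * (firstVarY ℓ (νx t : Measure X) y
            - expectedLoss ℓ (νx t : Measure X) (νy t : Measure Y)) ∂(νy t : Measure Y))
      (Ici 0) t

end Game

end

/-! Fix pure strategies p and q. Let ν be transported by -γ∇W and reweighted at rate -α(W - c), with
W Λ-Lipschitz. The mass near p is measured by m(t) = ∫ (r(t) - ψ)₊² dν_t, where ψ is a C^1
approximation of the distance to p with |∇ψ| ≤ 2. If r grows at speed 2Λγ, the growth of r outweighs
whatever transport removes, and only the reweighting is left: m' ≥ -α (W(p) + Λρ - c) m, with ρ the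
final size of the region (`exists_localized_mass`). Neither a flow map nor a relative entropy is
needed.

For the second player W = -V_y and c = -L, so the value L cancels in the product of the two masses.
Grönwall's inequality, m(T) ≤ ρ² and m(0) ≥ η² ν₀(B(p,η)) ≥ e^{-(K+K')} η^{d+2} bound α∫(V_y(q) -
V_x(p)) by 4 log(ρ/η), the sum of the constants K, (d_x+d_y) log(1/η) and 2αΛρT
(`IsWFRFlow.integral_regret_le`). As the loss is bilinear, division by αT bounds the Nikaido–Isoda
error of the averages (`nikaidoIsoda_le`). With η = √(γ/α) and T = (αη)⁻¹ = t₀ one has ρ = (4+2Λ)η,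
and the error is η(O(1) + (d_x+d_y) log(1/η)) ≤ C η^{1-δ}.

The geometric input is that Lipschitz functions have bounded gradients, that 1-Lipschitz functions
have C^1 approximations with gradient at most 2, and that ball-volume constants exist. All three
come from Lipschitz estimates on charts. -/

noncomputable section

open Manifold Filter
open scoped Topology Convolution BoundedContinuousFunction

set_option linter.unusedSectionVars false

/-! ### Near-isometry of charts at their centre: the inverse chart. -/

section RiemannianChart

variable {d : ℕ} {M : Type*} [EMetricSpace M] [ChartedSpace (EuclideanSpace ℝ (Fin d)) M]
  [IsManifold (𝓡 d) 1 M] [RiemannianBundle (fun x : M ↦ TangentSpace (𝓡 d) x)]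
  [IsContinuousRiemannianBundle (EuclideanSpace ℝ (Fin d)) (fun x : M ↦ TangentSpace (𝓡 d) x)]
  [IsRiemannianManifold (𝓡 d) M]

/-- The identification of the model space with the tangent space at `x`. -/
def modelToTangent (d : ℕ) {M : Type*} [EMetricSpace M]
    [ChartedSpace (EuclideanSpace ℝ (Fin d)) M] [IsManifold (𝓡 d) 1 M]
    [RiemannianBundle (fun x : M ↦ TangentSpace (𝓡 d) x)] (x : M) :
    EuclideanSpace ℝ (Fin d) →L[ℝ] TangentSpace (𝓡 d) x :=
  (trivializationAt (EuclideanSpace ℝ (Fin d)) (fun x : M ↦ TangentSpace (𝓡 d) x) x).symmL ℝ x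

theorem modelToTangent_apply (x : M) (v : EuclideanSpace ℝ (Fin d)) :
    modelToTangent d x v = v := by
  have h := TangentBundle.symmL_trivializationAt (𝕜 := ℝ) (I := 𝓡 d) (mem_chart_source _ x)
  have h2 := mfderivWithin_range_extChartAt_symm (𝕜 := ℝ) (I := 𝓡 d) (x := x)
  rw [modelToTangent]
  exact congr($(h.trans h2) v)

/-- The metric is continuous, so the trivialization centred at `x₀` is almost isometric on nearby
fibres, and its inverse is the differential of the inverse chart. -/
theorem eventually_norm_mfderivWithin_extChartAt_symm_apply_le (x₀ : M) {r : ℝ} (hr : 1 < r) :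
    ∀ᶠ u in 𝓝 (extChartAt (𝓡 d) x₀ x₀), ∀ v : EuclideanSpace ℝ (Fin d),
      ‖(mfderivWithin 𝓘(ℝ, EuclideanSpace ℝ (Fin d)) (𝓡 d) (extChartAt (𝓡 d) x₀).symm
        (range (𝓡 d)) u : EuclideanSpace ℝ (Fin d) →L[ℝ] _) v‖ ≤ r * ‖modelToTangent d x₀ v‖ := by
  have h1 := eventually_norm_symmL_trivializationAt_comp_self_lt (EuclideanSpace ℝ (Fin d))
    (fun x : M ↦ TangentSpace (𝓡 d) x) x₀ hr
  have h2 : ContinuousAt (extChartAt (𝓡 d) x₀).symm (extChartAt (𝓡 d) x₀ x₀) :=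
    continuousAt_extChartAt_symm x₀
  rw [ContinuousAt, extChartAt_to_inv] at h2
  filter_upwards [h2.eventually h1, extChartAt_target_mem_nhds x₀] with u hu hut v
  have hs : (extChartAt (𝓡 d) x₀).symm u ∈ (chartAt (EuclideanSpace ℝ (Fin d)) x₀).source := by
    simpa using (extChartAt (𝓡 d) x₀).map_target hut
  have h3 := TangentBundle.symmL_trivializationAt (𝕜 := ℝ) (I := 𝓡 d) hs
  rw [(extChartAt (𝓡 d) x₀).right_inv hut] at h3
  have h5 : (trivializationAt (EuclideanSpace ℝ (Fin d))
      (fun x : M ↦ TangentSpace (𝓡 d) x) x₀).continuousLinearMapAt ℝ x₀ (modelToTangent d x₀ v)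
      = v := by
    rw [modelToTangent, Trivialization.continuousLinearMapAt_symmL]
    exact FiberBundle.mem_baseSet_trivializationAt' x₀
  have h4 := ContinuousLinearMap.le_of_opNorm_le _ hu.le (modelToTangent d x₀ v)
  rw [ContinuousLinearMap.comp_apply, h5] at h4
  have h6 := congr($h3 v)
  exact le_of_eq_of_le (congrArg norm h6.symm) h4

theorem eventually_norm_modelToTangent_mfderiv_extChartAt_le (x₀ : M) {r : ℝ} (hr : 1 < r) :
    ∀ᶠ y in 𝓝 x₀, ∀ v : TangentSpace (𝓡 d) y,
      ‖modelToTangent d x₀ (mfderiv (𝓡 d) 𝓘(ℝ, EuclideanSpace ℝ (Fin d))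
        (extChartAt (𝓡 d) x₀) y v)‖ ≤ r * ‖v‖ := by
  filter_upwards [eventually_norm_symmL_trivializationAt_self_comp_lt (EuclideanSpace ℝ (Fin d))
    (fun x : M ↦ TangentSpace (𝓡 d) x) x₀ hr, chart_source_mem_nhds (EuclideanSpace ℝ (Fin d)) x₀] with y hy hys v
  have h4 := ContinuousLinearMap.le_of_opNorm_le _ hy.le v
  rw [ContinuousLinearMap.comp_apply,
    TangentBundle.continuousLinearMapAt_trivializationAt (𝕜 := ℝ) (I := 𝓡 d) hys] at h4
  exact h4

/-- The inverse chart sends the straight segment from `u` to `v` to a curve whose length bounds the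
Riemannian distance. -/
theorem exists_ball_edist_extChartAt_symm_le (x₀ : M) {r : ℝ} (hr : 1 < r) :
    ∃ ρ > 0, Metric.ball (extChartAt (𝓡 d) x₀ x₀) ρ ⊆ (extChartAt (𝓡 d) x₀).target ∧
      ∀ u ∈ Metric.ball (extChartAt (𝓡 d) x₀ x₀) ρ, ∀ v ∈ Metric.ball (extChartAt (𝓡 d) x₀ x₀) ρ,
        edist ((extChartAt (𝓡 d) x₀).symm u) ((extChartAt (𝓡 d) x₀).symm v) ≤
          ENNReal.ofReal (r * ‖modelToTangent d x₀ (v - u)‖) := by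
  obtain ⟨ρ, hρ, hsub⟩ := Metric.mem_nhds_iff.1 (inter_mem (extChartAt_target_mem_nhds x₀)
    (eventually_norm_mfderivWithin_extChartAt_symm_apply_le (d := d) x₀ hr))
  refine ⟨ρ, hρ, fun u hu ↦ (hsub hu).1, fun u hu v hv ↦ ?_⟩
  let η := ContinuousAffineMap.lineMap (R := ℝ) u v
  let γ := (extChartAt (𝓡 d) x₀).symm ∘ η
  have hη : ∀ t ∈ Icc (0 : ℝ) 1, η t ∈ Metric.ball (extChartAt (𝓡 d) x₀ x₀) ρ := by
    intro t ht
    have : η t ∈ segment ℝ u v := by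
      rw [segment_eq_image_lineMap]
      exact ⟨t, ht, rfl⟩
    exact (convex_ball _ _).segment_subset hu hv this
  have hηs : ContMDiffOn 𝓘(ℝ, ℝ) 𝓘(ℝ, EuclideanSpace ℝ (Fin d)) 1 η (Icc 0 1) := by
    apply ContMDiff.contMDiffOn
    rw [contMDiff_iff_contDiff]
    exact ContinuousAffineMap.contDiff _
  have h1 : riemannianEDist (𝓡 d) (γ 0) (γ 1) ≤ pathELength (𝓡 d) γ 0 1 :=
    riemannianEDist_le_pathELength ((contMDiffOn_extChartAt_symm x₀).comp hηs
      fun t ht ↦ (hsub (hη t ht)).1) rfl rfl zero_le_one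
  have e0 : γ 0 = (extChartAt (𝓡 d) x₀).symm u := by
    simp [γ, η, ContinuousAffineMap.coe_lineMap_eq]
  have e1 : γ 1 = (extChartAt (𝓡 d) x₀).symm v := by
    simp [γ, η, ContinuousAffineMap.coe_lineMap_eq]
  rw [e0, e1, ← IsRiemannianManifold.out] at h1
  refine h1.trans ?_
  rw [pathELength_eq_lintegral_mfderivWithin_Icc]
  calc _ ≤ ∫⁻ t in Icc (0 : ℝ) 1, ENNReal.ofReal (r * ‖modelToTangent d x₀ (v - u)‖) := by
        refine setLIntegral_mono' measurableSet_Icc fun t ht ↦ ?_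
        have hd : mfderivWithin 𝓘(ℝ, ℝ) (𝓡 d) γ (Icc 0 1) t =
            (mfderivWithin 𝓘(ℝ, EuclideanSpace ℝ (Fin d)) (𝓡 d) (extChartAt (𝓡 d) x₀).symm
              (range (𝓡 d)) (η t)) ∘L
            (mfderivWithin 𝓘(ℝ, ℝ) 𝓘(ℝ, EuclideanSpace ℝ (Fin d)) η (Icc 0 1) t) := by
          apply mfderivWithin_comp
          · exact mdifferentiableWithinAt_extChartAt_symm (hsub (hη t ht)).1
          · exact hηs.mdifferentiableOn one_ne_zero t ht
          · intro s hs
            simp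
          · rw [uniqueMDiffWithinAt_iff_uniqueDiffWithinAt]
            exact uniqueDiffOn_Icc zero_lt_one t ht
        have hl : (mfderivWithin 𝓘(ℝ, ℝ) 𝓘(ℝ, EuclideanSpace ℝ (Fin d)) η (Icc 0 1) t :
            ℝ →L[ℝ] EuclideanSpace ℝ (Fin d)) (1 : ℝ) = v - u := by
          rw [mfderivWithin_eq_fderivWithin, fderivWithin_eq_fderiv
            (uniqueDiffOn_Icc zero_lt_one t ht) (ContinuousAffineMap.differentiableAt _)]
          have hlin : (ContinuousAffineMap.lineMap (R := ℝ) u v).contLinear 1 =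
              (AffineMap.lineMap (k := ℝ) u v).linear 1 := rfl
          simp only [η, ContinuousAffineMap.fderiv]
          exact hlin.trans (by simp)
        have hd1 := congr($hd (1 : ℝ))
        have hd2 := hd1.trans (congrArg (mfderivWithin 𝓘(ℝ, EuclideanSpace ℝ (Fin d)) (𝓡 d)
          (extChartAt (𝓡 d) x₀).symm (range (𝓡 d)) (η t)) hl)
        have h3 := (hsub (hη t ht)).2 (v - u)
        refine le_of_eq_of_le (congrArg enorm hd2) ?_
        rw [← ofReal_norm]
        exact ENNReal.ofReal_le_ofReal h3
    _ = _ := by simp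

end RiemannianChart

/-! ### Lipschitz estimates for charts, and passage from local to global Lipschitz bounds. -/

section RiemannianLipschitz

variable {d : ℕ} {M : Type*} [EMetricSpace M] [ChartedSpace (EuclideanSpace ℝ (Fin d)) M]
  [IsManifold (𝓡 d) 1 M] [RiemannianBundle (fun x : M ↦ TangentSpace (𝓡 d) x)]
  [IsContinuousRiemannianBundle (EuclideanSpace ℝ (Fin d)) (fun x : M ↦ TangentSpace (𝓡 d) x)]
  [IsRiemannianManifold (𝓡 d) M]

theorem eventually_enorm_mfderiv_extChartAt_apply_le (x₀ : M) :
    ∃ C : ℝ≥0, ∀ᶠ y in 𝓝 x₀, ∀ v : TangentSpace (𝓡 d) y,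
      enorm (E := EuclideanSpace ℝ (Fin d))
        (mfderiv (𝓡 d) 𝓘(ℝ, EuclideanSpace ℝ (Fin d)) (extChartAt (𝓡 d) x₀) y v) ≤ C * ‖v‖ₑ := by
  obtain ⟨C, hC, h⟩ := eventually_norm_trivializationAt_lt (EuclideanSpace ℝ (Fin d))
    (fun x : M ↦ TangentSpace (𝓡 d) x) x₀
  lift C to ℝ≥0 using hC.le
  refine ⟨C, ?_⟩
  filter_upwards [h, chart_source_mem_nhds (EuclideanSpace ℝ (Fin d)) x₀] with y hy hys v
  have hn : ‖(trivializationAt (EuclideanSpace ℝ (Fin d))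
      (fun x : M ↦ TangentSpace (𝓡 d) x) x₀).continuousLinearMapAt ℝ y‖ₑ ≤ C := by
    simp only [enorm, nnnorm]
    exact_mod_cast hy.le
  have h4 := (ContinuousLinearMap.le_opENorm ((trivializationAt (EuclideanSpace ℝ (Fin d))
    (fun x : M ↦ TangentSpace (𝓡 d) x) x₀).continuousLinearMapAt ℝ y) v).trans
    (mul_le_mul_left hn _)
  rw [TangentBundle.continuousLinearMapAt_trivializationAt (𝕜 := ℝ) (I := 𝓡 d) hys] at h4
  exact h4

/-- An almost shortest curve between two points is pushed through the chart, and its speed is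
integrated. A general `A` serves both the model norm and the norm of the tangent space at `x₀`. -/
theorem exists_lipschitzOnWith_comp_extChartAt {V : Type*} [NormedAddCommGroup V] [NormedSpace ℝ V]
    (A : EuclideanSpace ℝ (Fin d) →L[ℝ] V) (x₀ : M) {C : ℝ≥0}
    (hC : ∀ᶠ y in 𝓝 x₀, ∀ v : TangentSpace (𝓡 d) y,
      ‖A (mfderiv (𝓡 d) 𝓘(ℝ, EuclideanSpace ℝ (Fin d)) (extChartAt (𝓡 d) x₀) y v)‖ₑ ≤ C * ‖v‖ₑ) :
    ∃ s ∈ 𝓝 x₀, LipschitzOnWith C (A ∘ extChartAt (𝓡 d) x₀) s := by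
  obtain ⟨c, hc, hsub⟩ := EMetric.mem_nhds_iff.1 (inter_mem hC
    (chart_source_mem_nhds (EuclideanSpace ℝ (Fin d)) x₀))
  have hc3 : 0 < c / 3 := ENNReal.div_pos hc.ne' (by simp)
  -- A curve of length below 2c/3 that starts within c/3 of `x₀` stays in the ball of radius c,
  -- where the derivative bound holds.
  refine ⟨Metric.eball x₀ (c / 3), Metric.eball_mem_nhds _ hc3, fun y hy z hz ↦ ?_⟩
  have hyz : edist y z < c / 3 + c / 3 :=
    (edist_triangle_right y z x₀).trans_lt (ENNReal.add_lt_add hy hz)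
  have key : ∀ b, edist y z < b → b ≤ c / 3 + c / 3 →
      edist (A (extChartAt (𝓡 d) x₀ y)) (A (extChartAt (𝓡 d) x₀ z)) ≤ C * b := by
    intro b hb hbc
    rw [IsRiemannianManifold.out (I := 𝓡 d)] at hb
    obtain ⟨γ, hγy, hγz, hγs, hγ, -⟩ :=
      exists_lt_locally_constant_of_riemannianEDist_lt hb zero_lt_one
    have hmem : ∀ t ∈ Icc (0 : ℝ) 1, γ t ∈ Metric.eball x₀ c := by
      intro t ht
      have h1 : edist (γ 0) (γ t) ≤ pathELength (𝓡 d) γ 0 1 := by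
        rw [IsRiemannianManifold.out (I := 𝓡 d)]
        exact (riemannianEDist_le_pathELength hγs.contMDiffOn rfl rfl ht.1).trans
          (pathELength_mono le_rfl ht.2)
      rw [hγy] at h1
      have h2 : edist (γ t) x₀ < c / 3 + c / 3 + c / 3 := by
        calc edist (γ t) x₀ ≤ edist y (γ t) + edist y x₀ := edist_triangle_left _ _ _
          _ < c / 3 + c / 3 + c / 3 := ENNReal.add_lt_add (h1.trans_lt (hγ.trans_le hbc)) hy
      rwa [ENNReal.add_thirds] at h2
    let γ' := extChartAt (𝓡 d) x₀ ∘ γ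
    have hCγ : ContMDiffOn 𝓘(ℝ, ℝ) 𝓘(ℝ, EuclideanSpace ℝ (Fin d)) 1 γ' (Icc 0 1) :=
      contMDiffOn_extChartAt.comp (I' := 𝓡 d)
        (t := (chartAt (EuclideanSpace ℝ (Fin d)) x₀).source)
        hγs.contMDiffOn fun t ht ↦ (hsub (hmem t ht)).2
    rw [contMDiffOn_iff_contDiffOn] at hCγ
    have e : edist (A (extChartAt (𝓡 d) x₀ y)) (A (extChartAt (𝓡 d) x₀ z)) =
        ‖(A ∘ γ') 1 - (A ∘ γ') 0‖ₑ := by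
      rw [edist_comm, edist_eq_enorm_sub]
      simp [γ', hγy, hγz]
    rw [e]
    calc ‖(A ∘ γ') 1 - (A ∘ γ') 0‖ₑ
      _ ≤ ∫⁻ t in Icc (0 : ℝ) 1, ‖derivWithin (A ∘ γ') (Icc 0 1) t‖ₑ :=
        enorm_sub_le_lintegral_derivWithin_Icc_of_contDiffOn_Icc
          (A.contDiff.comp_contDiffOn hCγ) zero_le_one
      _ ≤ ∫⁻ t in Icc (0 : ℝ) 1, C * ‖mfderivWithin 𝓘(ℝ, ℝ) (𝓡 d) γ (Icc 0 1) t 1‖ₑ := by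
        apply setLIntegral_mono' measurableSet_Icc (fun t ht ↦ ?_)
        have h1 : mfderivWithin 𝓘(ℝ, ℝ) 𝓘(ℝ, EuclideanSpace ℝ (Fin d)) γ' (Icc 0 1) t =
            (mfderiv (𝓡 d) 𝓘(ℝ, EuclideanSpace ℝ (Fin d)) (extChartAt (𝓡 d) x₀) (γ t)) ∘L
              (mfderivWithin 𝓘(ℝ, ℝ) (𝓡 d) γ (Icc 0 1) t) := by
          apply mfderiv_comp_mfderivWithin
          · exact mdifferentiableAt_extChartAt (hsub (hmem t ht)).2
          · exact (hγs.mdifferentiable one_ne_zero).mdifferentiableOn _ ht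
          · rw [uniqueMDiffWithinAt_iff_uniqueDiffWithinAt]
            exact uniqueDiffOn_Icc zero_lt_one _ ht
        have h2 : derivWithin γ' (Icc 0 1) t =
            (mfderiv (𝓡 d) 𝓘(ℝ, EuclideanSpace ℝ (Fin d)) (extChartAt (𝓡 d) x₀) (γ t))
              (mfderivWithin 𝓘(ℝ, ℝ) (𝓡 d) γ (Icc 0 1) t 1) := by
          rw [← fderivWithin_derivWithin, ← mfderivWithin_eq_fderivWithin]
          exact congr($h1 1)
        have h3 : derivWithin (A ∘ γ') (Icc 0 1) t = A (derivWithin γ' (Icc 0 1) t) :=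
          (A.hasFDerivAt.comp_hasDerivWithinAt t
            (hCγ.differentiableOn one_ne_zero t ht).hasDerivWithinAt).derivWithin
            (uniqueDiffOn_Icc zero_lt_one t ht)
        rw [h3, h2]
        exact (hsub (hmem t ht)).1 _
      _ = C * pathELength (𝓡 d) γ 0 1 := by
        rw [lintegral_const_mul' _ _ ENNReal.coe_ne_top,
          pathELength_eq_lintegral_mfderivWithin_Icc]
      _ ≤ C * b := by gcongr
  -- The infimum over `b` is taken after dividing by `C`, so `C = 0` is treated apart.
  rcases eq_or_ne C 0 with rfl | hC0
  · obtain ⟨b, hb1, hb2⟩ := exists_between hyz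
    simpa using key b hb1 hb2.le
  have hC0' : (C : ℝ≥0∞) ≠ 0 := by simpa using hC0
  rw [← ENNReal.div_le_iff' hC0' ENNReal.coe_ne_top]
  refine le_of_forall_gt_imp_ge_of_dense fun b hb ↦ ?_
  rw [ENNReal.div_le_iff' hC0' ENNReal.coe_ne_top]
  rcases le_total b (c / 3 + c / 3) with h | h
  · exact key b hb h
  · exact (key _ hyz le_rfl).trans (by gcongr)

theorem exists_lipschitzOnWith_extChartAt (x₀ : M) :
    ∃ C : ℝ≥0, ∃ s ∈ 𝓝 x₀, LipschitzOnWith C (extChartAt (𝓡 d) x₀) s := by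
  obtain ⟨C, hC⟩ := eventually_enorm_mfderiv_extChartAt_apply_le (d := d) x₀
  exact ⟨C, exists_lipschitzOnWith_comp_extChartAt (ContinuousLinearMap.id ℝ _) x₀ hC⟩

/-- The chart at `x₀`, with values in the tangent space at `x₀`. -/
def tangentChart (d : ℕ) {M : Type*} [EMetricSpace M]
    [ChartedSpace (EuclideanSpace ℝ (Fin d)) M] [IsManifold (𝓡 d) 1 M]
    [RiemannianBundle (fun x : M ↦ TangentSpace (𝓡 d) x)] (x₀ : M) :
    M → TangentSpace (𝓡 d) x₀ :=
  modelToTangent d x₀ ∘ extChartAt (𝓡 d) x₀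

/-- Near its base point, the chart with values in the tangent space is almost an isometry. -/
theorem exists_mem_nhds_tangentChart_bilipschitz (x₀ : M) {r : ℝ≥0} (hr : 1 < r) :
    ∃ s ∈ 𝓝 x₀, s ⊆ (chartAt (EuclideanSpace ℝ (Fin d)) x₀).source ∧
      LipschitzOnWith r (tangentChart d x₀) s ∧
      ∀ y ∈ s, ∀ z ∈ s, edist y z ≤ r * edist (tangentChart d x₀ y) (tangentChart d x₀ z) := by
  have hr' : (1 : ℝ) < r := hr
  obtain ⟨s, hs, hLip⟩ := exists_lipschitzOnWith_comp_extChartAt (modelToTangent d x₀) x₀ (C := r) (by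
    filter_upwards [eventually_norm_modelToTangent_mfderiv_extChartAt_le (d := d) x₀ hr'] with y hy v
    rw [← ofReal_norm, ← ofReal_norm, ← ENNReal.ofReal_coe_nnreal, ← ENNReal.ofReal_mul r.coe_nonneg]
    exact ENNReal.ofReal_le_ofReal (hy v))
  obtain ⟨ρ, hρ, -, hb⟩ := exists_ball_edist_extChartAt_symm_le (d := d) x₀ hr'
  refine ⟨s ∩ (chartAt (EuclideanSpace ℝ (Fin d)) x₀).source ∩
    extChartAt (𝓡 d) x₀ ⁻¹' Metric.ball (extChartAt (𝓡 d) x₀ x₀) ρ,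
    inter_mem (inter_mem hs (chart_source_mem_nhds _ _))
      ((continuousAt_extChartAt x₀).preimage_mem_nhds (Metric.ball_mem_nhds _ hρ)),
    fun y hy ↦ hy.1.2, hLip.mono fun y hy ↦ hy.1.1, fun y hy z hz ↦ ?_⟩
  have h := hb _ hz.2 _ hy.2
  rw [(extChartAt (𝓡 d) x₀).left_inv (by simpa using hz.1.2),
    (extChartAt (𝓡 d) x₀).left_inv (by simpa using hy.1.2), edist_comm,
    ENNReal.ofReal_mul r.coe_nonneg, map_sub, ofReal_norm, ENNReal.ofReal_coe_nnreal,
    ← edist_eq_enorm_sub] at h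
  exact h

/-- Points closer than a Lebesgue number share a neighbourhood of the cover. For the others the
finite diameter of the range, divided by that number, is a Lipschitz constant. -/
theorem LocallyLipschitz.exists_lipschitzWith {Z : Type*} [PseudoEMetricSpace Z] [CompactSpace Z]
    {f : Z → ℝ} (hf : LocallyLipschitz f) : ∃ K, LipschitzWith K f := by
  choose K t ht hK using hf
  obtain ⟨T, hT⟩ := CompactSpace.elim_nhds_subcover (fun z ↦ interior (t z))
    fun z ↦ interior_mem_nhds.2 (ht z)
  obtain ⟨δ, hδ, hδT⟩ := lebesgue_number_lemma_of_emetric (s := univ)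
    (c := fun z : T ↦ interior (t z)) isCompact_univ (fun _ ↦ isOpen_interior) (by
      intro x hx
      have := hT.ge hx
      simpa using this)
  obtain ⟨δ', hδ', hδδ'⟩ := ENNReal.lt_iff_exists_nnreal_btwn.1 hδ
  have hδ'0 : 0 < δ' := by simpa using hδ'
  have hcont : Continuous f := by
    refine continuous_iff_continuousAt.2 fun z ↦ ?_
    exact (hK z).continuousOn.continuousAt (ht z)
  obtain ⟨B, hB⟩ : ∃ B : ℝ≥0, (B : ℝ≥0∞) = Metric.ediam (range f) :=
    ⟨_, ENNReal.coe_toNNReal (isCompact_range hcont).isBounded.ediam_ne_top⟩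
  refine ⟨max (T.sup K) (B / δ'), fun x y ↦ ?_⟩
  rcases lt_or_ge (edist y x) δ' with h | h
  · obtain ⟨⟨z, hz⟩, hsub⟩ := hδT x (mem_univ x)
    have hx : x ∈ t z := interior_subset (hsub (Metric.mem_eball_self hδ))
    have hy : y ∈ t z := interior_subset (hsub (h.trans hδδ'))
    refine (hK z hx hy).trans ?_
    gcongr
    exact (Finset.le_sup hz).trans (le_max_left _ _)
  · calc edist (f x) (f y) ≤ Metric.ediam (range f) :=
          Metric.edist_le_ediam_of_mem (mem_range_self _) (mem_range_self _)
      _ = ((B / δ' : ℝ≥0) : ℝ≥0∞) * δ' := by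
          rw [← hB, ← ENNReal.coe_mul, div_mul_cancel₀ _ hδ'0.ne']
      _ ≤ _ := by
          rw [edist_comm x y]
          gcongr
          exact le_max_right _ _

end RiemannianLipschitz

/-! ### Mollification in a normed space. -/

section Smoothing

/-- A Lipschitz function on a finite-dimensional normed space is a uniform limit of smooth functions
with the same Lipschitz constant. -/
theorem LipschitzWith.exists_contDiff_dist_le {V : Type*} [NormedAddCommGroup V] [NormedSpace ℝ V]
    [FiniteDimensional ℝ V] {K : ℝ≥0} {f : V → ℝ} (hf : LipschitzWith K f) {τ : ℝ} (hτ : 0 < τ) :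
    ∃ g : V → ℝ, ContDiff ℝ ∞ g ∧ LipschitzWith K g ∧ ∀ x, dist (g x) (f x) ≤ τ := by
  borelize V
  let μ : Measure V := Measure.addHaar
  have hK : (0 : ℝ) < K + 1 := by positivity
  -- Averaging at scale τ/(K+1) moves `f` by at most Kτ/(K+1) ≤ τ; the added 1 covers `K = 0`.
  let φ : ContDiffBump (0 : V) := ⟨τ / (K + 1) / 2, τ / (K + 1), by positivity, by
    have : 0 < τ / (K + 1) := by positivity
    linarith⟩
  have hint : ∀ x, Integrable (fun t ↦ φ.normed μ t • f (x - t)) μ := fun x ↦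
    ((φ.continuous_normed (μ := μ)).smul (hf.continuous.comp (by fun_prop))).integrable_of_hasCompactSupport
      (φ.hasCompactSupport_normed.smul_right)
  refine ⟨φ.normed μ ⋆[ContinuousLinearMap.lsmul ℝ ℝ, μ] f,
    φ.hasCompactSupport_normed.contDiff_convolution_left _ φ.contDiff_normed
      hf.continuous.locallyIntegrable, LipschitzWith.of_dist_le_mul fun x y ↦ ?_, fun x ↦ ?_⟩
  · simp only [convolution_def, ContinuousLinearMap.lsmul_apply]
    rw [dist_eq_norm, ← integral_sub (hint x) (hint y)]
    calc _ ≤ ∫ t, φ.normed μ t * (K * dist x y) ∂μ := by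
          refine norm_integral_le_of_norm_le
            ((φ.integrable_normed (μ := μ)).mul_const _) (Eventually.of_forall fun t ↦ ?_)
          rw [← smul_sub, norm_smul, Real.norm_of_nonneg (φ.nonneg_normed t), ← dist_eq_norm]
          refine mul_le_mul_of_nonneg_left ?_ (φ.nonneg_normed t)
          simpa using hf.dist_le_mul (x - t) (y - t)
      _ = K * dist x y := by
          rw [integral_mul_const, φ.integral_normed, one_mul]
  · refine φ.dist_normed_convolution_le hf.continuous.aestronglyMeasurable fun y hy ↦ ?_
    have h1 := hf.dist_le_mul y x
    have h2 : dist y x ≤ τ / (K + 1) := (Metric.mem_ball.1 hy).le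
    calc dist (f y) (f x) ≤ K * (τ / (K + 1)) := h1.trans (by gcongr)
      _ ≤ (K + 1) * (τ / (K + 1)) := by
          have : 0 < τ / (K + 1) := by positivity
          nlinarith
      _ = τ := by field_simp

end Smoothing

/-! ### Gradients of Lipschitz functions. -/

section RiemannianLipschitz

variable {d : ℕ} {M : Type*} [EMetricSpace M] [ChartedSpace (EuclideanSpace ℝ (Fin d)) M]
  [IsManifold (𝓡 d) 1 M] [RiemannianBundle (fun x : M ↦ TangentSpace (𝓡 d) x)]
  [IsContinuousRiemannianBundle (EuclideanSpace ℝ (Fin d)) (fun x : M ↦ TangentSpace (𝓡 d) x)]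
  [IsRiemannianManifold (𝓡 d) M]

/-- Difference quotients along a line in the chart are controlled up to a factor `r`, for every `r >
1`, since the inverse chart is almost isometric at its centre; then `r` tends to 1. -/
theorem abs_le_of_hasFDerivAt_comp_extChartAt_symm {f : M → ℝ} {x : M} {Λ : ℝ≥0}
    (hf : ∀ᶠ y in 𝓝 x, edist (f y) (f x) ≤ Λ * edist y x) {L : EuclideanSpace ℝ (Fin d) →L[ℝ] ℝ}
    (hL : HasFDerivAt (f ∘ (extChartAt (𝓡 d) x).symm) L (extChartAt (𝓡 d) x x))
    (v : EuclideanSpace ℝ (Fin d)) : |L v| ≤ Λ * ‖modelToTangent d x v‖ := by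
  have key : ∀ r : ℝ, 1 < r → |L v| ≤ r * (Λ * ‖modelToTangent d x v‖) := by
    intro r hr
    obtain ⟨ρ, hρ, hsub, hb⟩ := exists_ball_edist_extChartAt_symm_le (d := d) x hr
    set u := extChartAt (𝓡 d) x x with hu
    have hl : HasDerivAt (fun t : ℝ ↦ u + t • v) v 0 := by
      simpa using ((hasDerivAt_id (0 : ℝ)).smul_const v).const_add u
    have hl0 : Tendsto (fun t : ℝ ↦ u + t • v) (𝓝 0) (𝓝 u) := by
      simpa using hl.continuousAt.tendsto
    have hD := HasFDerivAt.comp_hasDerivAt_of_eq (0 : ℝ) hL hl (by simp)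
    refine hD.le_of_lip' (C := r * (Λ * ‖modelToTangent d x v‖)) (by positivity) ?_
    have hcont : Tendsto (fun t : ℝ ↦ (extChartAt (𝓡 d) x).symm (u + t • v)) (𝓝 0) (𝓝 x) := by
      have h := continuousAt_extChartAt_symm (I := 𝓡 d) x
      rw [ContinuousAt, extChartAt_to_inv] at h
      exact h.comp hl0
    filter_upwards [hcont.eventually hf, hl0.eventually (Metric.ball_mem_nhds u hρ)] with t ht htb
    have h1 := hb _ (Metric.mem_ball_self hρ) _ htb
    rw [hu, extChartAt_to_inv, ← hu, edist_comm] at h1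
    have h2 := ht.trans (mul_le_mul_right h1 _)
    rw [← ENNReal.ofReal_coe_nnreal, ← ENNReal.ofReal_mul Λ.coe_nonneg, edist_dist,
      ENNReal.ofReal_le_ofReal_iff (by positivity), Real.dist_eq] at h2
    have e : u + t • v - u = t • v := by abel
    rw [e, map_smul, norm_smul] at h2
    have e2 : (f ∘ (extChartAt (𝓡 d) x).symm) (u + (0 : ℝ) • v) = f x := by
      simp [hu]
    simp only [Function.comp_apply] at e2 ⊢
    rw [e2, sub_zero, Real.norm_eq_abs]
    calc _ ≤ _ := h2
      _ = _ := by ring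
  have hlim : Tendsto (fun r : ℝ ↦ r * (Λ * ‖modelToTangent d x v‖)) (𝓝[>] 1)
      (𝓝 (1 * (Λ * ‖modelToTangent d x v‖))) :=
    (tendsto_id.mul_const _).mono_left nhdsWithin_le_nhds
  rw [one_mul] at hlim
  exact ge_of_tendsto hlim (by filter_upwards [self_mem_nhdsWithin] with r hr using key r hr)

/-- A function that is `Λ`-Lipschitz at a point has a gradient of norm at most `Λ` there. -/
theorem norm_riemannianGrad_le_of_eventually_edist_le {f : M → ℝ} {x : M} {Λ : ℝ≥0}
    (hf : ∀ᶠ y in 𝓝 x, edist (f y) (f x) ≤ Λ * edist y x) : ‖riemannianGrad d f x‖ ≤ Λ := by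
  have hsq : ‖riemannianGrad d f x‖ * ‖riemannianGrad d f x‖ ≤ Λ * ‖riemannianGrad d f x‖ := by
    rw [← real_inner_self_eq_norm_mul_norm, inner_riemannianGrad]
    by_cases hd : MDifferentiableAt (𝓡 d) 𝓘(ℝ, ℝ) f x
    · have hD := hd.hasMFDerivAt.2
      rw [ModelWithCorners.range_eq_univ] at hD
      have h := abs_le_of_hasFDerivAt_comp_extChartAt_symm hf hD.hasFDerivAt_of_univ
        (riemannianGrad d f x)
      exact (le_abs_self _).trans (h.trans_eq
        (congrArg (fun w : TangentSpace (𝓡 d) x ↦ (Λ : ℝ) * ‖w‖) (modelToTangent_apply x _)))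
    -- Where `f` is not differentiable, `mfderiv` is zero by convention, and so is the gradient.
    · rw [mfderiv_zero_of_not_mdifferentiableAt hd]
      exact le_of_eq_of_le (b := (0 : ℝ)) rfl (by positivity)
  by_contra! h
  nlinarith [Λ.coe_nonneg]

theorem LipschitzWith.norm_riemannianGrad_le {f : M → ℝ} {Λ : ℝ≥0} (hf : LipschitzWith Λ f)
    (x : M) : ‖riemannianGrad d f x‖ ≤ Λ :=
  norm_riemannianGrad_le_of_eventually_edist_le (Eventually.of_forall fun y ↦ hf y x)

end RiemannianLipschitz

/-! ### C^1 functions on compact manifolds and their products are Lipschitz. -/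

section LocallyLipschitz

/-- The model is left general so that single manifolds and products are both covered. -/
theorem ContMDiffAt.exists_lipschitzOnWith_of_extChartAt {E H N : Type*} [NormedAddCommGroup E]
    [NormedSpace ℝ E] [TopologicalSpace H] {I : ModelWithCorners ℝ E H} [I.Boundaryless]
    [PseudoEMetricSpace N] [ChartedSpace H N] {f : N → ℝ} {p : N}
    (hf : ContMDiffAt I 𝓘(ℝ, ℝ) 1 f p)
    (hp : ∃ C : ℝ≥0, ∃ s ∈ 𝓝 p, LipschitzOnWith C (extChartAt I p) s) :
    ∃ K : ℝ≥0, ∃ s ∈ 𝓝 p, LipschitzOnWith K f s := by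
  obtain ⟨C, s, hs, hC⟩ := hp
  have h1 := (contMDiffAt_iff.1 hf).2
  rw [I.range_eq_univ, contDiffWithinAt_univ] at h1
  obtain ⟨K, t, ht, hK⟩ := h1.exists_lipschitzOnWith
  refine ⟨K * C, s ∩ (extChartAt I p ⁻¹' t ∩ (extChartAt I p).source), inter_mem hs
    (inter_mem ((continuousAt_extChartAt p).preimage_mem_nhds ht) (extChartAt_source_mem_nhds p)),
    ?_⟩
  have h2 : LipschitzOnWith (K * C) ((extChartAt 𝓘(ℝ, ℝ) (f p) ∘ f ∘ (extChartAt I p).symm) ∘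
      extChartAt I p) (s ∩ (extChartAt I p ⁻¹' t ∩ (extChartAt I p).source)) :=
    hK.comp (hC.mono inter_subset_left) fun y hy ↦ hy.2.1
  intro y hy z hz
  have h3 := h2 hy hz
  simp only [Function.comp_apply, (extChartAt I p).left_inv hy.2.2,
    (extChartAt I p).left_inv hz.2.2] at h3
  exact h3

variable {d : ℕ} {M : Type*} [EMetricSpace M] [ChartedSpace (EuclideanSpace ℝ (Fin d)) M]
  [IsManifold (𝓡 d) 1 M] [RiemannianBundle (fun x : M ↦ TangentSpace (𝓡 d) x)]
  [IsContinuousRiemannianBundle (EuclideanSpace ℝ (Fin d)) (fun x : M ↦ TangentSpace (𝓡 d) x)]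
  [IsRiemannianManifold (𝓡 d) M]
  {d' : ℕ} {N : Type*} [EMetricSpace N] [ChartedSpace (EuclideanSpace ℝ (Fin d')) N]
  [IsManifold (𝓡 d') 1 N] [RiemannianBundle (fun x : N ↦ TangentSpace (𝓡 d') x)]
  [IsContinuousRiemannianBundle (EuclideanSpace ℝ (Fin d')) (fun x : N ↦ TangentSpace (𝓡 d') x)]
  [IsRiemannianManifold (𝓡 d') N]

/-- A `C^1` function on a compact Riemannian manifold is Lipschitz. -/
theorem ContMDiff.exists_lipschitzWith [CompactSpace M] {f : M → ℝ}
    (hf : ContMDiff (𝓡 d) 𝓘(ℝ, ℝ) 1 f) : ∃ K, LipschitzWith K f :=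
  LocallyLipschitz.exists_lipschitzWith fun p ↦
    (hf p).exists_lipschitzOnWith_of_extChartAt (exists_lipschitzOnWith_extChartAt p)

/-- A `C^1` function on a product of compact Riemannian manifolds is Lipschitz. -/
theorem ContMDiff.exists_lipschitzWith_prod [CompactSpace M] [CompactSpace N] {f : M × N → ℝ}
    (hf : ContMDiff ((𝓡 d).prod (𝓡 d')) 𝓘(ℝ, ℝ) 1 f) : ∃ K, LipschitzWith K f := by
  refine LocallyLipschitz.exists_lipschitzWith fun p ↦
    (hf p).exists_lipschitzOnWith_of_extChartAt ?_
  obtain ⟨C, s, hs, hC⟩ := exists_lipschitzOnWith_extChartAt (d := d) p.1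
  obtain ⟨C', s', hs', hC'⟩ := exists_lipschitzOnWith_extChartAt (d := d') p.2
  refine ⟨max C C', s ×ˢ s', prod_mem_nhds hs hs', fun y hy z hz ↦ ?_⟩
  rw [extChartAt_prod]
  refine max_le ?_ ?_
  · refine (hC hy.1 hz.1).trans ?_
    gcongr
    exacts [le_max_left _ _, le_max_left _ _]
  · refine (hC' hy.2 hz.2).trans ?_
    gcongr
    exacts [le_max_right _ _, le_max_right _ _]

end LocallyLipschitz

/-! ### C^1 approximation of Lipschitz functions on a manifold. -/

section Smoothing

variable {d : ℕ} {M : Type*} [EMetricSpace M] [ChartedSpace (EuclideanSpace ℝ (Fin d)) M]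
  [IsManifold (𝓡 d) ∞ M] [RiemannianBundle (fun x : M ↦ TangentSpace (𝓡 d) x)]
  [IsContinuousRiemannianBundle (EuclideanSpace ℝ (Fin d)) (fun x : M ↦ TangentSpace (𝓡 d) x)]
  [IsRiemannianManifold (𝓡 d) M]

/-- A `1`-Lipschitz function on a Riemannian manifold is, near every point, a uniform limit of `C^1`
functions whose Lipschitz constants are arbitrarily close to `1`. -/
theorem LipschitzWith.exists_isOpen_contMDiffOn_dist_le {f : M → ℝ} (hf : LipschitzWith 1 f)
    (x₀ : M) {r : ℝ≥0} (hr : 1 < r) :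
    ∃ U : Set M, IsOpen U ∧ x₀ ∈ U ∧ ∀ τ : ℝ, 0 < τ → ∃ g : M → ℝ,
      ContMDiffOn (𝓡 d) 𝓘(ℝ, ℝ) 1 g U ∧ LipschitzOnWith (r * r) g U ∧
      ∀ y ∈ U, |g y - f y| ≤ τ := by
  obtain ⟨s, hs, hsrc, hΦ, hΦ'⟩ := exists_mem_nhds_tangentChart_bilipschitz (d := d) x₀ hr
  refine ⟨interior s, isOpen_interior, mem_interior_iff_mem_nhds.2 hs, fun τ hτ ↦ ?_⟩
  have : FiniteDimensional ℝ (TangentSpace (𝓡 d) x₀) :=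
    inferInstanceAs (FiniteDimensional ℝ (EuclideanSpace ℝ (Fin d)))
  have : Nonempty M := ⟨x₀⟩
  set Φ := tangentChart d x₀
  have hinj : InjOn Φ s := by
    intro y hy z hz h
    have := hΦ' y hy z hz
    simpa [h] using this
  -- Read in the chart, `f` is `r`-Lipschitz; it is extended to the whole tangent space so that it
  -- can be mollified. Composing with the chart costs the second factor `r`.
  obtain ⟨F, hF, hFf⟩ : ∃ F : TangentSpace (𝓡 d) x₀ → ℝ, LipschitzWith r F ∧
      ∀ y ∈ s, F (Φ y) = f y := by
    have hl : LipschitzOnWith r (fun w ↦ f (Function.invFunOn Φ s w)) (Φ '' s) := by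
      rintro _ ⟨y, hy, rfl⟩ _ ⟨z, hz, rfl⟩
      simp only [hinj.leftInvOn_invFunOn hy, hinj.leftInvOn_invFunOn hz]
      have h1 := hf y z
      rw [ENNReal.coe_one, one_mul] at h1
      exact h1.trans (hΦ' y hy z hz)
    obtain ⟨F, hF, hFe⟩ := hl.extend_real
    refine ⟨F, hF, fun y hy ↦ ?_⟩
    rw [← hFe (mem_image_of_mem _ hy)]
    simp only [hinj.leftInvOn_invFunOn hy]
  obtain ⟨h, hhs, hhl, hhF⟩ := hF.exists_contDiff_dist_le hτ
  refine ⟨h ∘ Φ, ?_, hhl.comp_lipschitzOnWith (hΦ.mono interior_subset), fun y hy ↦ ?_⟩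
  · have h1 : ContDiff ℝ 1 (h ∘ modelToTangent d x₀) :=
      (hhs.of_le (by exact_mod_cast le_top)).comp (modelToTangent d x₀).contDiff
    exact h1.contMDiff.comp_contMDiffOn (contMDiffOn_extChartAt.mono
      (interior_subset.trans hsrc))
  · have h1 := hhF (Φ y)
    rw [hFf y (interior_subset hy)] at h1
    exact h1

/-- A `1`-Lipschitz function on a compact Riemannian manifold is a uniform limit of `C^1` functions
with bounded gradients. -/
theorem LipschitzWith.exists_contMDiff_norm_riemannianGrad_le [CompactSpace M] {f : M → ℝ}
    (hf : LipschitzWith 1 f) {τ : ℝ} (hτ : 0 < τ) :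
    ∃ g : M → ℝ, ContMDiff (𝓡 d) 𝓘(ℝ, ℝ) 1 g ∧ (∀ x, |g x - f x| ≤ τ) ∧
      ∀ x, ‖riemannianGrad d g x‖ ≤ 2 := by
  choose U hUo hxU hU using fun x₀ : M ↦ hf.exists_isOpen_contMDiffOn_dist_le (d := d) x₀
    (r := 5 / 4) (by rw [← NNReal.coe_lt_coe]; norm_num)
  obtain ⟨T, hT⟩ := CompactSpace.elim_nhds_subcover U fun x ↦ (hUo x).mem_nhds (hxU x)
  obtain ⟨ρ, hρ⟩ := SmoothPartitionOfUnity.exists_isSubordinate (𝓡 d) (s := univ) isClosed_univ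
    (fun i : T ↦ U i) (fun i ↦ hUo i) (by
      intro x hx
      simpa using hT.ge hx)
  have hρL : ∀ i : T, ∃ K, LipschitzWith K (ρ i) := fun i ↦
    ContMDiff.exists_lipschitzWith (d := d) ((ρ i).contMDiff.of_le (by exact_mod_cast le_top))
  choose L hL using hρL
  set Λ : ℝ := ∑ i, (L i : ℝ) with hΛ
  have hΛ0 : 0 ≤ Λ := Finset.sum_nonneg fun i _ ↦ (L i).coe_nonneg
  -- The local approximations contribute (5/4)² = 25/16 to the gradient and the partition of unity
  -- at most Λσ ≤ 1/4, which together stay below 2.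
  set σ : ℝ := min τ (1 / (4 * (Λ + 1))) with hσ
  have hσ0 : 0 < σ := lt_min hτ (by positivity)
  have hσΛ : Λ * σ ≤ 1 / 4 := by
    calc Λ * σ ≤ (Λ + 1) * (1 / (4 * (Λ + 1))) := by
          gcongr
          · linarith
          · exact min_le_right _ _
      _ = 1 / 4 := by field_simp
  choose g hgs hgl hgf using fun i : T ↦ hU i σ hσ0
  have hsum : ∀ x, ∑ i, ρ i x = 1 := fun x ↦ by
    rw [← finsum_eq_sum_of_fintype]; exact ρ.sum_eq_one (mem_univ x)
  have hρU : ∀ (i : T) (x : M), ρ i x ≠ 0 → x ∈ U i := fun i x hx ↦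
    hρ i (subset_tsupport _ hx)
  refine ⟨fun x ↦ ∑ i, ρ i x * g i x, ?_, fun x ↦ ?_, fun x ↦ ?_⟩
  · have : ContMDiff (𝓡 d) 𝓘(ℝ, ℝ) 1 fun x ↦ ∑ᶠ i, ρ i x • g i x :=
      hρ.contMDiff_finsum_smul (n := 1) (fun i ↦ hUo i) hgs
    simpa only [finsum_eq_sum_of_fintype, smul_eq_mul] using this
  · have e : ∑ i, ρ i x * g i x - f x = ∑ i, ρ i x * (g i x - f x) := by
      simp only [mul_sub, Finset.sum_sub_distrib, ← Finset.sum_mul, hsum, one_mul]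
    rw [e]
    calc _ ≤ ∑ i, |ρ i x * (g i x - f x)| := Finset.abs_sum_le_sum_abs _ _
      _ ≤ ∑ i, ρ i x * τ := by
        refine Finset.sum_le_sum fun i _ ↦ ?_
        rw [abs_mul, abs_of_nonneg (ρ.nonneg i x)]
        by_cases h0 : ρ i x = 0
        · simp [h0]
        · exact mul_le_mul_of_nonneg_left ((hgf i x (hρU i x h0)).trans (min_le_left _ _))
            (ρ.nonneg i x)
      _ = τ := by rw [← Finset.sum_mul, hsum, one_mul]
  · refine norm_riemannianGrad_le_of_eventually_edist_le (Λ := 2) ?_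
    -- The subtracted terms f(x)(ρᵢ(y) - ρᵢ(x)) sum to zero because ∑ρᵢ = 1. After the subtraction
    -- the variation of ρᵢ only multiplies gᵢ - f, which is at most σ.
    have hloc : ∀ i : T, ∀ᶠ y in 𝓝 x,
        |ρ i y * g i y - ρ i x * g i x - f x * (ρ i y - ρ i x)| ≤
          (ρ i y * (25 / 16) + L i * σ) * (edist y x).toReal := by
      intro i
      by_cases hx : x ∈ U i
      · filter_upwards [(hUo i).mem_nhds hx, Metric.eball_mem_nhds x one_pos] with y hy hyx
        have hfin : edist y x ≠ ⊤ := (hyx.trans_le le_top).ne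
        have h1 : |g i y - g i x| ≤ 25 / 16 * (edist y x).toReal := by
          have h := hgl i hy hx
          rw [edist_dist, Real.dist_eq] at h
          have h' := ENNReal.toReal_mono (by finiteness) h
          rw [ENNReal.toReal_ofReal (abs_nonneg _), ENNReal.toReal_mul] at h'
          refine h'.trans_eq ?_
          congr 1
          norm_num
        have h2 : |ρ i y - ρ i x| ≤ L i * (edist y x).toReal := by
          have h := hL i y x
          rw [edist_dist, Real.dist_eq] at h
          have h' := ENNReal.toReal_mono (by finiteness) h
          rwa [ENNReal.toReal_ofReal (abs_nonneg _), ENNReal.toReal_mul] at h'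
        have h3 := hgf i x hx
        have e : ρ i y * g i y - ρ i x * g i x - f x * (ρ i y - ρ i x) =
            ρ i y * (g i y - g i x) + (ρ i y - ρ i x) * (g i x - f x) := by ring
        rw [e]
        refine (abs_add_le _ _).trans ?_
        rw [abs_mul, abs_mul, abs_of_nonneg (ρ.nonneg i y), add_mul]
        refine add_le_add ?_ ?_
        · rw [mul_assoc]
          exact mul_le_mul_of_nonneg_left h1 (ρ.nonneg i y)
        · rw [mul_right_comm]
          exact mul_le_mul h2 h3 (abs_nonneg _) (by positivity)
      · have hx' : x ∉ tsupport (ρ i) := fun h ↦ hx (hρ i h)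
        filter_upwards [(isClosed_tsupport _).isOpen_compl.mem_nhds hx'] with y hy
        rw [image_eq_zero_of_notMem_tsupport hx', image_eq_zero_of_notMem_tsupport hy]
        simp only [zero_mul, sub_self, mul_zero, abs_zero, zero_add]
        positivity
    filter_upwards [eventually_all.2 hloc, Metric.eball_mem_nhds x one_pos] with y hy hyx
    have hfin : edist y x ≠ ⊤ := (hyx.trans_le le_top).ne
    have e : ∑ i, ρ i y * g i y - ∑ i, ρ i x * g i x =
        ∑ i, (ρ i y * g i y - ρ i x * g i x - f x * (ρ i y - ρ i x)) := by
      simp only [Finset.sum_sub_distrib, ← Finset.mul_sum, hsum]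
      ring
    have hb : |∑ i, ρ i y * g i y - ∑ i, ρ i x * g i x| ≤ 2 * (edist y x).toReal := by
      rw [e]
      calc _ ≤ ∑ i, (ρ i y * (25 / 16) + L i * σ) * (edist y x).toReal :=
            (Finset.abs_sum_le_sum_abs _ _).trans (Finset.sum_le_sum fun i _ ↦ hy i)
        _ = (25 / 16 + Λ * σ) * (edist y x).toReal := by
            rw [← Finset.sum_mul, Finset.sum_add_distrib, ← Finset.sum_mul, ← Finset.sum_mul, hsum,
              one_mul]
        _ ≤ _ := by
            gcongr
            linarith
    rw [edist_dist, Real.dist_eq, ← ENNReal.ofReal_toReal hfin, ← ENNReal.ofReal_coe_nnreal,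
      ← ENNReal.ofReal_mul NNReal.zero_le_coe]
    exact ENNReal.ofReal_le_ofReal (by simpa using hb)

end Smoothing

/-! ### Existence of ball-volume constants. -/

section BallVolume

theorem LipschitzOnWith.euclideanHausdorffMeasure_image_le {X Y : Type*} [EMetricSpace X]
    [MeasurableSpace X] [BorelSpace X] [EMetricSpace Y] [MeasurableSpace Y] [BorelSpace Y]
    {K : ℝ≥0} {f : X → Y} {s : Set X} (h : LipschitzOnWith K f s) (d : ℕ) :
    (Measure.euclideanHausdorffMeasure d : Measure Y) (f '' s) ≤
      (K : ℝ≥0∞) ^ d * (Measure.euclideanHausdorffMeasure d : Measure X) s := by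
  simp_rw [Measure.euclideanHausdorffMeasure_def, Measure.smul_apply, ENNReal.smul_def, smul_eq_mul]
  rw [mul_left_comm]
  gcongr
  simpa using h.hausdorffMeasure_image_le (d := d) (by positivity)

variable {d : ℕ} {M : Type*} [EMetricSpace M] [ChartedSpace (EuclideanSpace ℝ (Fin d)) M]
  [IsManifold (𝓡 d) 1 M] [RiemannianBundle (fun x : M ↦ TangentSpace (𝓡 d) x)]
  [IsContinuousRiemannianBundle (EuclideanSpace ℝ (Fin d)) (fun x : M ↦ TangentSpace (𝓡 d) x)]
  [IsRiemannianManifold (𝓡 d) M] [MeasurableSpace M] [BorelSpace M]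

/-- The ball of radius `r` contains the image of a Euclidean ball of comparable radius. The chart is
Lipschitz, so that image has Hausdorff measure at least a constant times `r ^ d`. -/
theorem exists_mem_nhds_le_riemannianVolume_eball (x₀ : M) :
    ∃ W ∈ 𝓝 x₀, ∃ c : ℝ, 0 < c ∧ ∀ x ∈ W, ∀ r : ℝ, 0 < r → r ≤ 1 →
      ENNReal.ofReal (c * r ^ d) ≤ riemannianVolume d M (Metric.eball x (ENNReal.ofReal r)) := by
  obtain ⟨C₁, s, hs, hC₁⟩ := exists_lipschitzOnWith_extChartAt (d := d) x₀
  obtain ⟨ρ, hρ, hsub, hb⟩ := exists_ball_edist_extChartAt_symm_le (d := d) x₀ one_lt_two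
  set φ := extChartAt (𝓡 d) x₀ with hφ
  set C₂ : ℝ := 2 * (‖modelToTangent d x₀‖ + 1) with hC₂
  have hC₂0 : 0 < C₂ := by positivity
  obtain ⟨a, ha, has⟩ := EMetric.mem_nhds_iff.1 hs
  obtain ⟨b, hb0, hba⟩ := ENNReal.lt_iff_exists_nnreal_btwn.1 (ENNReal.half_pos ha.ne')
  have hb0' : 0 < b := by simpa using hb0
  -- Shrinking by `r₁` keeps the Euclidean ball in the chart target and its image in `s`, for all `r
  -- ≤ 1` at once.
  set r₁ : ℝ := min (min b 1) (C₂ * (ρ / 2)) with hr₁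
  have hr₁0 : 0 < r₁ := by
    refine lt_min (lt_min (by exact_mod_cast hb0') one_pos) (by positivity)
  set κ : ℝ≥0∞ := volume (Metric.ball (0 : EuclideanSpace ℝ (Fin d)) 1) with hκ
  have hκ0 : 0 < κ := Metric.measure_ball_pos _ _ one_pos
  have hκt : κ ≠ ⊤ := measure_ball_lt_top.ne
  have hκ' : 0 < κ.toReal := ENNReal.toReal_pos hκ0.ne' hκt
  refine ⟨Metric.eball x₀ (a / 2) ∩ (φ.source ∩ φ ⁻¹' Metric.ball (φ x₀) (ρ / 2)),
    inter_mem (Metric.eball_mem_nhds _ (ENNReal.half_pos ha.ne'))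
      (inter_mem (extChartAt_source_mem_nhds x₀)
        ((continuousAt_extChartAt x₀).preimage_mem_nhds (Metric.ball_mem_nhds _ (by positivity)))),
    κ.toReal * (r₁ / C₂) ^ d / (C₁ + 1) ^ d, by positivity, fun x hx r hr hr1 ↦ ?_⟩
  set D := φ.symm '' Metric.ball (φ x) (r₁ * r / C₂) with hD
  have hballsub : Metric.ball (φ x) (r₁ * r / C₂) ⊆ Metric.ball (φ x₀) ρ := by
    refine Metric.ball_subset_ball' ?_
    have h1 : dist (φ x) (φ x₀) < ρ / 2 := hx.2.2
    have h2 : r₁ * r / C₂ ≤ ρ / 2 := by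
      rw [div_le_iff₀ hC₂0]
      calc r₁ * r ≤ r₁ * 1 := by gcongr
        _ ≤ ρ / 2 * C₂ := by
          rw [mul_one, mul_comm]
          exact min_le_right _ _
    linarith
  have hxball : φ x ∈ Metric.ball (φ x₀) ρ := hballsub (Metric.mem_ball_self (by positivity))
  have hDball : D ⊆ Metric.eball x (ENNReal.ofReal (r₁ * r)) := by
    rintro _ ⟨u, hu, rfl⟩
    have h1 := hb u (hballsub hu) (φ x) hxball
    rw [φ.left_inv hx.2.1] at h1
    refine h1.trans_lt ((ENNReal.ofReal_lt_ofReal_iff (by positivity)).2 ?_)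
    have h2 : ‖φ x - u‖ < r₁ * r / C₂ := by
      rw [← dist_eq_norm']
      exact hu
    calc 2 * ‖modelToTangent d x₀ (φ x - u)‖ ≤ C₂ * ‖φ x - u‖ := by
          rw [hC₂, mul_assoc]
          gcongr
          refine ((modelToTangent d x₀).le_opNorm _).trans ?_
          gcongr
          linarith
      _ < C₂ * (r₁ * r / C₂) := by gcongr
      _ = r₁ * r := by field_simp
  have hDs : D ⊆ s := by
    refine (hDball.trans fun y hy ↦ ?_).trans has
    have h1 : ENNReal.ofReal (r₁ * r) ≤ b := by
      rw [← ENNReal.ofReal_coe_nnreal]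
      refine ENNReal.ofReal_le_ofReal ?_
      calc r₁ * r ≤ r₁ * 1 := by gcongr
        _ ≤ b := by
          rw [mul_one]
          exact (min_le_left _ _).trans (min_le_left _ _)
    calc edist y x₀ ≤ edist y x + edist x x₀ := edist_triangle _ _ _
      _ < a / 2 + a / 2 := ENNReal.add_lt_add (hy.trans_le (h1.trans hba.le)) hx.1
      _ = a := ENNReal.add_halves a
  have himg : φ '' D = Metric.ball (φ x) (r₁ * r / C₂) := by
    rw [hD, image_image]
    refine (image_congr fun u hu ↦ φ.right_inv (hsub (hballsub hu))).trans (by simp)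
  have hC₁' : LipschitzOnWith (C₁ + 1) φ D := (hC₁.mono hDs).weaken (by simp)
  have h1 := hC₁'.euclideanHausdorffMeasure_image_le d
  rw [himg, EuclideanSpace.euclideanHausdorffMeasure_eq_volume,
    Measure.addHaar_ball_of_pos _ _ (by positivity), ← hκ] at h1
  have h2 : riemannianVolume d M D ≤ riemannianVolume d M (Metric.eball x (ENNReal.ofReal r)) := by
    refine measure_mono (hDball.trans (Metric.eball_subset_eball (ENNReal.ofReal_le_ofReal ?_)))
    have : r₁ ≤ 1 := (min_le_left _ _).trans (min_le_right _ _)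
    nlinarith
  refine le_trans ?_ h2
  have e : κ.toReal * (r₁ / C₂) ^ d / (C₁ + 1) ^ d * r ^ d =
      ((r₁ * r / C₂) ^ d * κ.toReal) / (C₁ + 1) ^ d := by
    rw [mul_div_assoc, div_pow, div_pow, mul_pow]
    ring
  rw [e, ENNReal.ofReal_div_of_pos (by positivity), ENNReal.ofReal_mul (by positivity),
    ENNReal.ofReal_toReal hκt]
  refine ENNReal.div_le_of_le_mul' ?_
  have e2 : ENNReal.ofReal (((C₁ : ℝ) + 1) ^ d) = ((C₁ + 1 : ℝ≥0) : ℝ≥0∞) ^ d := by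
    rw [ENNReal.ofReal_pow (by positivity), ← ENNReal.ofReal_coe_nnreal]
    simp
  rw [e2]
  simpa [riemannianVolume] using h1

/-- A compact Riemannian manifold has a ball-volume constant. -/
theorem exists_isBallVolumeConst [CompactSpace M] : ∃ K, IsBallVolumeConst d M K := by
  obtain ⟨c, hc, h⟩ : ∃ c : ℝ, 0 < c ∧ ∀ x ∈ (univ : Set M), ∀ r : ℝ, 0 < r → r ≤ 1 →
      ENNReal.ofReal (c * r ^ d) ≤ riemannianVolume d M (Metric.eball x (ENNReal.ofReal r)) := by
    refine isCompact_univ.induction_on (p := fun s ↦ ∃ c : ℝ, 0 < c ∧ ∀ x ∈ s, ∀ r : ℝ, 0 < r →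
      r ≤ 1 → ENNReal.ofReal (c * r ^ d) ≤
        riemannianVolume d M (Metric.eball x (ENNReal.ofReal r))) ⟨1, one_pos, by simp⟩ ?_ ?_ ?_
    · rintro s t hst ⟨c, hc, h⟩
      exact ⟨c, hc, fun x hx ↦ h x (hst hx)⟩
    · rintro s t ⟨c, hc, h⟩ ⟨c', hc', h'⟩
      refine ⟨min c c', lt_min hc hc', fun x hx r hr hr1 ↦ ?_⟩
      rcases hx with hx | hx
      · refine le_trans (ENNReal.ofReal_le_ofReal ?_) (h x hx r hr hr1)
        gcongr
        exact min_le_left _ _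
      · refine le_trans (ENNReal.ofReal_le_ofReal ?_) (h' x hx r hr hr1)
        gcongr
        exact min_le_right _ _
    · intro x _
      obtain ⟨W, hW, c, hc, h⟩ := exists_mem_nhds_le_riemannianVolume_eball (d := d) x
      exact ⟨W, mem_nhdsWithin_of_mem_nhds hW, c, hc, h⟩
  refine ⟨-Real.log c, fun x r hr hr1 ↦ ?_⟩
  rw [neg_neg, Real.exp_log hc]
  exact h x (mem_univ x) r hr hr1

end BallVolume

/-! ### Weakly continuous curves of measures and their time averages. -/

section WeakContinuity

/-- A weakly continuous curve of probability measures is measurable. -/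
theorem ProbabilityMeasure.measurable_coe_of_continuous {T X : Type*} [TopologicalSpace T]
    [MeasurableSpace T] [OpensMeasurableSpace T] [TopologicalSpace X] [MeasurableSpace X]
    [BorelSpace X] [HasOuterApproxClosed X] {ν : T → ProbabilityMeasure X} (hν : Continuous ν) :
    Measurable fun s ↦ (ν s : Measure X) := by
  refine Measurable.measure_of_isPiSystem_of_isProbabilityMeasure
    (BorelSpace.measurable_eq.trans borel_eq_generateFrom_isClosed) isPiSystem_isClosed
    fun F hF ↦ ?_
  refine measurable_of_tendsto_metrizable
    (f := fun n s ↦ ∫⁻ x, (IsClosed.apprSeq hF n x : ℝ≥0∞) ∂(ν s : Measure X)) (fun n ↦ ?_) ?_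
  · exact ((ProbabilityMeasure.continuous_lintegral_boundedContinuousFunction
      (IsClosed.apprSeq hF n)).comp hν).measurable
  · rw [tendsto_pi_nhds]
    intro s
    exact HasOuterApproxClosed.tendsto_lintegral_apprSeq hF _

theorem Continuous.integrable_of_compactSpace {X : Type*} [TopologicalSpace X] [CompactSpace X]
    [MeasurableSpace X] [OpensMeasurableSpace X] {f : X → ℝ} (hf : Continuous f) (μ : Measure X)
    [IsFiniteMeasureOnCompacts μ] : Integrable f μ :=
  hf.integrable_of_hasCompactSupport (HasCompactSupport.of_compactSpace f)

variable {X : Type*} [TopologicalSpace X] [CompactSpace X] [MeasurableSpace X] [BorelSpace X]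

theorem ContinuousOn.aemeasurable_probabilityMeasure [HasOuterApproxClosed X]
    {ν : ℝ → ProbabilityMeasure X}
    (hν : ∀ f : X → ℝ, Continuous f → ContinuousOn (fun s ↦ ∫ x, f x ∂(ν s : Measure X)) (Ici 0))
    (t : ℝ) : AEMeasurable (fun s ↦ (ν s : Measure X)) (volume.restrict (Ioc 0 t)) := by
  -- Continuity is known for nonnegative times only, so the curve is frozen at its initial value
  -- before time 0.
  have hc : Continuous fun s : ℝ ↦ ν (max s 0) := by
    rw [ProbabilityMeasure.continuous_iff_forall_continuousMap_continuous_integral]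
    intro f
    exact (hν f f.continuous).comp_continuous (by fun_prop) fun s ↦ mem_Ici.2 (le_max_right _ _)
  refine ⟨_, ProbabilityMeasure.measurable_coe_of_continuous hc, ?_⟩
  filter_upwards [ae_restrict_mem measurableSet_Ioc] with s hs
  rw [max_eq_left hs.1.le]

theorem isProbabilityMeasure_timeAverage {ν : ℝ → ProbabilityMeasure X} {t : ℝ} (ht : 0 < t)
    (hν : AEMeasurable (fun s ↦ (ν s : Measure X)) (volume.restrict (Ioc 0 t))) :
    IsProbabilityMeasure (timeAverage ν t) := by
  refine ⟨?_⟩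
  rw [timeAverage, Measure.smul_apply, Measure.bind_apply MeasurableSet.univ hν]
  simp only [measure_univ, lintegral_one, Measure.restrict_apply_univ, Real.volume_Ioc,
    sub_zero, smul_eq_mul]
  rw [← ENNReal.ofReal_mul (by positivity), inv_mul_cancel₀ ht.ne', ENNReal.ofReal_one]

theorem integral_timeAverage [HasOuterApproxClosed X] {ν : ℝ → ProbabilityMeasure X}
    (hν : ∀ f : X → ℝ, Continuous f → ContinuousOn (fun s ↦ ∫ x, f x ∂(ν s : Measure X)) (Ici 0))
    {t : ℝ} (ht : 0 < t) {f : X → ℝ} (hf : Continuous f) :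
    ∫ x, f x ∂(timeAverage ν t) = t⁻¹ * ∫ s in Ioc 0 t, ∫ x, f x ∂(ν s : Measure X) := by
  have hm := ContinuousOn.aemeasurable_probabilityMeasure hν t
  have := isProbabilityMeasure_timeAverage ht hm
  have hcont : ∀ (g : X → ℝ) (hg : Continuous g),
      IntegrableOn (fun s ↦ ∫ x, g x ∂(ν s : Measure X)) (Ioc 0 t) := fun g hg ↦
    ((hν g hg).mono Icc_subset_Ici_self).integrableOn_Icc.mono_set Ioc_subset_Icc_self
  have hpos : ∀ g : X → ℝ, Continuous g → (∀ x, 0 ≤ g x) →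
      ∫ x, g x ∂(timeAverage ν t) = t⁻¹ * ∫ s in Ioc 0 t, ∫ x, g x ∂(ν s : Measure X) := by
    intro g hg h0
    rw [integral_eq_lintegral_of_nonneg_ae (Eventually.of_forall h0) hg.aestronglyMeasurable,
      timeAverage, lintegral_smul_measure,
      Measure.lintegral_bind hm (by fun_prop),
      integral_eq_lintegral_of_nonneg_ae
        (Eventually.of_forall fun s ↦ integral_nonneg h0) (hcont g hg).1,
      smul_eq_mul, ENNReal.toReal_mul, ENNReal.toReal_ofReal (by positivity)]
    congr 3 with s
    rw [ofReal_integral_eq_lintegral_ofReal (hg.integrable_of_compactSpace _) (Eventually.of_forall h0)]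
  -- Subtracting a lower bound reduces to nonnegative functions, for which integration against
  -- `bind` is a statement about `lintegral`.
  obtain ⟨c, hc⟩ := (isCompact_range hf).bddBelow
  have h1 := hpos (fun x ↦ f x - c) (by fun_prop) fun x ↦ sub_nonneg.2 (hc (mem_range_self x))
  rw [integral_sub (hf.integrable_of_compactSpace _) (integrable_const _)] at h1
  have h2 : ∀ s, ∫ x, (f x - c) ∂(ν s : Measure X) = ∫ x, f x ∂(ν s : Measure X) - c := fun s ↦ by
    rw [integral_sub (hf.integrable_of_compactSpace _) (integrable_const _)]
    simp
  simp only [h2] at h1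
  rw [integral_sub (hcont f hf) (integrableOn_const (by simp))] at h1
  simp only [integral_const, probReal_univ, smul_eq_mul, one_mul, measureReal_restrict_apply_univ,
    mul_sub] at h1
  have h3 : volume.real (Ioc 0 t) = t := by simp [Measure.real, ht.le]
  rw [h3, ← mul_assoc t⁻¹ t c, inv_mul_cancel₀ ht.ne', one_mul] at h1
  linarith

/-- If a curve of probability measures is continuous against `C^1` functions, then it is so against
continuous functions. -/
theorem continuousOn_integral_of_contMDiff {d : ℕ} {M : Type*} [EMetricSpace M] [CompactSpace M]
    [ChartedSpace (EuclideanSpace ℝ (Fin d)) M] [IsManifold (𝓡 d) ∞ M]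
    [MeasurableSpace M] [BorelSpace M] {ν : ℝ → ProbabilityMeasure M} {s : Set ℝ}
    (hν : ∀ φ : M → ℝ, ContMDiff (𝓡 d) 𝓘(ℝ, ℝ) 1 φ →
      ContinuousOn (fun s ↦ ∫ x, φ x ∂(ν s : Measure M)) s)
    {f : M → ℝ} (hf : Continuous f) : ContinuousOn (fun s ↦ ∫ x, f x ∂(ν s : Measure M)) s := by
  refine continuousOn_of_uniform_approx_of_continuousOn fun u hu ↦ ?_
  obtain ⟨ε, hε, hεu⟩ := Metric.mem_uniformity_dist.1 hu
  obtain ⟨g, hg⟩ := exists_contMDiffMap_forall_mem_convex_of_local_const (𝓡 d) (n := 1)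
    (t := fun x ↦ Metric.closedBall (f x) (ε / 2)) (fun x ↦ convex_closedBall _ _) fun x ↦
    ⟨f x, by
      filter_upwards [hf.continuousAt.eventually (Metric.closedBall_mem_nhds (f x) (half_pos hε))]
        with y hy
      rwa [Metric.mem_closedBall, dist_comm]⟩
  refine ⟨fun s ↦ ∫ x, g x ∂(ν s : Measure M), hν g g.contMDiff, fun t _ ↦ hεu ?_⟩
  rw [dist_eq_norm, ← integral_sub (hf.integrable_of_compactSpace _) (g.contMDiff.continuous.integrable_of_compactSpace _)]
  refine (norm_integral_le_of_norm_le_const (C := ε / 2)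
    (Eventually.of_forall fun x ↦ ?_)).trans_lt ?_
  · rw [← dist_eq_norm, dist_comm]
    exact hg x
  · simpa using half_lt_self hε

end WeakContinuity

/-! ### The C^1 cutoff profile u ↦ (u₊)². -/

section PosPartSq

/-- The remainder is uniform in `u`, so it can be integrated in space when the cutoff moves with
time. -/
theorem abs_max_zero_sq_sub_le (u v : ℝ) :
    |(max v 0) ^ 2 - (max u 0) ^ 2 - (v - u) * (2 * max u 0)| ≤ (v - u) ^ 2 := by
  rcases le_total u 0 with hu | hu <;> rcases le_total v 0 with hv | hv <;>
    simp only [max_eq_left, max_eq_right, hu, hv] <;> rw [abs_le] <;> constructor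
  · nlinarith [sq_nonneg (v - u)]
  · nlinarith [sq_nonneg (v - u)]
  · nlinarith [sq_nonneg (v - u), sq_nonneg v]
  · nlinarith [mul_nonneg hv (neg_nonneg.2 hu)]
  · nlinarith [mul_nonneg hu (neg_nonneg.2 hv)]
  · nlinarith [sq_nonneg v]
  · nlinarith [sq_nonneg (v - u)]
  · nlinarith

theorem hasDerivAt_max_zero_sq (u : ℝ) :
    HasDerivAt (fun u : ℝ ↦ (max u 0) ^ 2) (2 * max u 0) u := by
  refine .of_isLittleO ?_
  refine (Asymptotics.IsBigO.of_bound 1 (Eventually.of_forall fun v ↦ ?_)).trans_isLittleO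
    (Asymptotics.isLittleO_pow_sub_sub u one_lt_two)
  simpa using abs_max_zero_sq_sub_le u v

theorem contDiff_max_zero_sq : ContDiff ℝ 1 (fun u : ℝ ↦ (max u 0) ^ 2) := by
  refine contDiff_one_iff_deriv.2 ⟨fun u ↦ (hasDerivAt_max_zero_sq u).differentiableAt, ?_⟩
  rw [funext fun u ↦ (hasDerivAt_max_zero_sq u).deriv]
  fun_prop

end PosPartSq

/-! ### Grönwall's inequality from below. -/

section Gronwall

theorem mul_exp_integral_le_of_mul_le_deriv {m m' a : ℝ → ℝ} {T : ℝ} (hT : 0 ≤ T)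
    (hm : ∀ t ∈ Icc 0 T, HasDerivWithinAt m (m' t) (Ici 0) t) (ha : ContinuousOn a (Icc 0 T))
    (h : ∀ t ∈ Icc 0 T, a t * m t ≤ m' t) :
    m 0 * Real.exp (∫ t in Ioc 0 T, a t) ≤ m T := by
  -- The continuous extension of `a` by constants makes its primitive differentiable everywhere;
  -- m·exp(-A) is then nondecreasing on the interval.
  set b : ℝ → ℝ := fun t ↦ a (max 0 (min t T)) with hb
  have hbc : Continuous b := ha.comp_continuous (by fun_prop) fun t ↦
    ⟨le_max_left _ _, max_le hT (min_le_right _ _)⟩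
  have hba : ∀ t ∈ Icc 0 T, b t = a t := fun t ht ↦ by
    simp [hb, ht.1, ht.2]
  set A : ℝ → ℝ := fun t ↦ ∫ s in (0 : ℝ)..t, b s with hA
  have hAd : ∀ t, HasDerivAt A (b t) t := fun t ↦ hbc.integral_hasStrictDerivAt 0 t |>.hasDerivAt
  have hG : ∀ t ∈ Icc 0 T, HasDerivWithinAt (fun t ↦ m t * Real.exp (-A t))
      (m' t * Real.exp (-A t) + m t * (Real.exp (-A t) * (-b t))) (Ici 0) t := fun t ht ↦
    (hm t ht).mul (hAd t).neg.exp.hasDerivWithinAt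
  have key := image_le_of_deriv_right_le_deriv_boundary (a := 0) (b := T) (f := fun _ ↦ m 0)
    (f' := fun _ ↦ 0) continuousOn_const (fun t _ ↦ hasDerivWithinAt_const _ _ _)
    (B := fun t ↦ m t * Real.exp (-A t)) (by simp [hA])
    (fun t ht ↦ (hG t ht).continuousWithinAt.mono Icc_subset_Ici_self)
    (fun t ht ↦ (hG t (Ico_subset_Icc_self ht)).mono (Ici_subset_Ici.2 ht.1)) (fun t ht ↦ by
      have ht' := Ico_subset_Icc_self ht
      have h1 := h t ht'
      rw [hba t ht']
      have h2 := mul_nonneg (sub_nonneg.2 h1) (Real.exp_pos (-A t)).le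
      linarith) (right_mem_Icc.2 hT)
  have hAT : A T = ∫ t in Ioc 0 T, a t := by
    simp only [hA]
    rw [intervalIntegral.integral_of_le hT]
    exact setIntegral_congr_fun measurableSet_Ioc fun t ht ↦ hba t (Ioc_subset_Icc_self ht)
  rw [← hAT]
  calc m 0 * Real.exp (A T) ≤ m T * Real.exp (-A T) * Real.exp (A T) := by gcongr
    _ = m T := by rw [mul_assoc, ← Real.exp_add]; simp

end Gronwall

/-! ### The mass in a growing ball. -/

section Evolution

variable {d : ℕ} {M : Type*} [EMetricSpace M] [CompactSpace M]
  [ChartedSpace (EuclideanSpace ℝ (Fin d)) M]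
  [IsManifold (𝓡 d) ∞ M] [RiemannianBundle (fun x : M ↦ TangentSpace (𝓡 d) x)]
  [IsContinuousRiemannianBundle (EuclideanSpace ℝ (Fin d)) (fun x : M ↦ TangentSpace (𝓡 d) x)]
  [IsRiemannianManifold (𝓡 d) M] [MeasurableSpace M] [BorelSpace M]

theorem inner_riemannianGrad_comp {h : ℝ → ℝ} {h' : ℝ} {ψ : M → ℝ} {x : M}
    (hh : HasDerivAt h h' (ψ x)) (hψ : MDifferentiableAt (𝓡 d) 𝓘(ℝ, ℝ) ψ x)
    (w : TangentSpace (𝓡 d) x) :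
    inner ℝ (riemannianGrad d (fun y ↦ h (ψ y)) x) w = h' * inner ℝ (riemannianGrad d ψ x) w := by
  rw [inner_riemannianGrad, inner_riemannianGrad]
  have h1 : HasMFDerivAt 𝓘(ℝ, ℝ) 𝓘(ℝ, ℝ) h (ψ x) (ContinuousLinearMap.toSpanSingleton ℝ h') :=
    hasMFDerivAt_iff_hasFDerivAt.2 hh.hasFDerivAt
  have h2 := (h1.comp x hψ.hasMFDerivAt).mfderiv
  refine (congr($h2 w)).trans ?_
  exact mul_comm (G := ℝ) _ _

/-- If `ν` is transported by `-γ ∇W` and reweighted at rate `-α (W - c)`, then the mass of `ν` in a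
ball that grows at a speed larger than `γ Λ` obeys a differential inequality in which the transport
does not enter. -/
theorem exists_localized_mass {ν : ℝ → ProbabilityMeasure M} {α γ : ℝ} (hα : 0 ≤ α) (hγ : 0 ≤ γ)
    {W : ℝ → M → ℝ} {c : ℝ → ℝ} {Λ : ℝ≥0} (hW : ∀ t, LipschitzWith Λ (W t))
    (hν : ∀ φ : M → ℝ, ContMDiff (𝓡 d) 𝓘(ℝ, ℝ) 1 φ → ∀ t, 0 ≤ t →
      HasDerivWithinAt (fun s ↦ ∫ x, φ x ∂(ν s : Measure M))
        (-γ * (∫ x, inner ℝ (riemannianGrad d φ x) (riemannianGrad d (W t) x) ∂(ν t : Measure M))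
          - α * ∫ x, φ x * (W t x - c t) ∂(ν t : Measure M)) (Ici 0) t)
    (p : M) {η T ρ : ℝ} (hη : 0 < η) (hT : 0 ≤ T) (hρ : ρ = 4 * η + 2 * Λ * γ * T) :
    ∃ m m' : ℝ → ℝ, (∀ t ∈ Icc 0 T, HasDerivWithinAt m (m' t) (Ici 0) t) ∧
      (∀ t ∈ Icc 0 T, -α * (W t p + Λ * ρ - c t) * m t ≤ m' t) ∧
      (∀ t, 0 ≤ m t) ∧ m T ≤ ρ ^ 2 ∧
      η ^ 2 * (ν 0 : Measure M).real (Metric.eball p (ENNReal.ofReal η)) ≤ m 0 := by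
  have hΛ := Λ.coe_nonneg
  have hρ0 : 0 < ρ := by
    have : 0 ≤ 2 * Λ * γ * T := by positivity
    linarith
  -- The truncation keeps the distance finite between components of `M`. It is harmless because the
  -- cutoff vanishes wherever `f` reaches `ρ`.
  set f : M → ℝ := fun x ↦ (min (edist p x) (ENNReal.ofReal ρ)).toReal with hf
  have hfin : ∀ x, min (edist p x) (ENNReal.ofReal ρ) ≠ ⊤ := fun x ↦
    ne_top_of_le_ne_top ENNReal.ofReal_ne_top (min_le_right _ _)
  have hfL : LipschitzWith 1 f := by
    refine LipschitzWith.of_edist_le fun x y ↦ ?_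
    have key : ∀ x y, min (edist p x) (ENNReal.ofReal ρ) ≤
        min (edist p y) (ENNReal.ofReal ρ) + edist x y := fun x y ↦ by
      rcases le_total (edist p y) (ENNReal.ofReal ρ) with h | h
      · rw [min_eq_left h]
        refine (min_le_left _ _).trans ?_
        rw [edist_comm x y]
        exact edist_triangle _ _ _
      · rw [min_eq_right h]
        exact (min_le_right _ _).trans le_self_add
    rcases eq_or_ne (edist x y) ⊤ with h | h
    · simp [h]
    rw [edist_dist, Real.dist_eq, ← ENNReal.ofReal_toReal h]
    refine ENNReal.ofReal_le_ofReal ?_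
    have h1 := ENNReal.toReal_mono (ENNReal.add_ne_top.2 ⟨hfin y, h⟩) (key x y)
    have h2 := ENNReal.toReal_mono (ENNReal.add_ne_top.2 ⟨hfin x, edist_comm x y ▸ h⟩) (key y x)
    rw [ENNReal.toReal_add (hfin _) h] at h1
    rw [ENNReal.toReal_add (hfin _) (edist_comm x y ▸ h), edist_comm y x] at h2
    rw [abs_le]
    constructor <;> simp only [hf] <;> linarith
  obtain ⟨ψ, hψs, hψf, hψg⟩ := hfL.exists_contMDiff_norm_riemannianGrad_le (d := d) hη
  have hψc : Continuous ψ := hψs.continuous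
  -- On the initial η-ball ψ ≤ 2η, so 3η leaves a margin η there; the fourth η in `ρ` absorbs |ψ -
  -- f| ≤ η. The speed 2Λγ is γ|∇ψ||∇W| at its largest.
  set r : ℝ → ℝ := fun t ↦ 3 * η + 2 * Λ * γ * t with hr
  have hrT : ∀ t ∈ Icc 0 T, r t ≤ ρ - η := by
    intro t ht
    have : 2 * Λ * γ * t ≤ 2 * Λ * γ * T := by
      have := ht.2
      gcongr
    simp only [hr]
    linarith
  have hcontν : ∀ {g : M → ℝ}, Continuous g →
      ContinuousOn (fun s ↦ ∫ x, g x ∂(ν s : Measure M)) (Ici 0) := fun hg ↦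
    continuousOn_integral_of_contMDiff (d := d)
      (fun φ hφ t ht ↦ (hν φ hφ t ht).continuousWithinAt) hg
  have hW0 : ∀ t, Continuous (W t) := fun t ↦ (hW t).continuous
  have hφs : ∀ t, ContMDiff (𝓡 d) 𝓘(ℝ, ℝ) 1 fun x ↦ (max (r t - ψ x) 0) ^ 2 := fun t ↦
    contDiff_max_zero_sq.contMDiff.comp (contMDiff_const.sub hψs)
  set J : ℝ → ℝ → ℝ := fun t s ↦ ∫ x, 2 * max (r t - ψ x) 0 ∂(ν s : Measure M) with hJ
  refine ⟨fun s ↦ ∫ x, (max (r s - ψ x) 0) ^ 2 ∂(ν s : Measure M), fun t ↦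
    (-γ * (∫ x, inner ℝ (riemannianGrad d (fun x ↦ (max (r t - ψ x) 0) ^ 2) x)
        (riemannianGrad d (W t) x) ∂(ν t : Measure M))
      - α * ∫ x, (max (r t - ψ x) 0) ^ 2 * (W t x - c t) ∂(ν t : Measure M)) +
      2 * Λ * γ * J t t, ?_, ?_, ?_, ?_, ?_⟩
  · intro t ht
    have h1 := hν _ (hφs t) t ht.1
    -- The flow equation differentiates fixed test functions only, so the cutoff is expanded around
    -- time `t`. The factor s - t means that mere continuity of `J t` suffices, although its
    -- integrand need not be C^1.
    have h2 : HasDerivWithinAt (fun s ↦ (2 * Λ * γ) * ((s - t) * J t s)) (2 * Λ * γ * J t t)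
        (Ici 0) t := by
      refine HasDerivWithinAt.const_mul _ ?_
      rw [hasDerivWithinAt_iff_tendsto_slope]
      have hJc : ContinuousOn (J t) (Ici 0) := hcontν (by fun_prop)
      refine ((hJc t ht.1).tendsto.mono_left (nhdsWithin_mono _ sdiff_subset)).congr' ?_
      filter_upwards [self_mem_nhdsWithin] with s hs
      have hst : s - t ≠ 0 := sub_ne_zero.2 hs.2
      rw [slope_def_field]
      simp only [sub_self, zero_mul, sub_zero]
      field_simp
    have h3 : HasDerivWithinAt (fun s ↦ ∫ x, ((max (r s - ψ x) 0) ^ 2 - (max (r t - ψ x) 0) ^ 2 -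
        (r s - r t) * (2 * max (r t - ψ x) 0)) ∂(ν s : Measure M)) 0 (Ici 0) t := by
      refine .of_isLittleO ?_
      refine (Asymptotics.IsBigO.of_bound ((2 * Λ * γ) ^ 2)
        (Eventually.of_forall fun s ↦ ?_)).trans_isLittleO
        ((Asymptotics.isLittleO_pow_sub_sub t one_lt_two).mono nhdsWithin_le_nhds)
      simp only [sub_self, zero_mul, integral_zero, sub_zero, smul_zero]
      refine (norm_integral_le_of_norm_le_const (C := (2 * Λ * γ) ^ 2 * (s - t) ^ 2)
        (Eventually.of_forall fun x ↦ ?_)).trans ?_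
      · have := abs_max_zero_sq_sub_le (r t - ψ x) (r s - ψ x)
        rw [sub_sub_sub_cancel_right] at this
        refine this.trans_eq ?_
        simp only [hr]
        ring
      · simp
    refine ((h1.add h2).add h3).congr_deriv (by ring) |>.congr_of_mem (fun s _ ↦ ?_) ht.1
    have i1 := (hφs s).continuous.integrable_of_compactSpace (ν s : Measure M)
    have i2 := (hφs t).continuous.integrable_of_compactSpace (ν s : Measure M)
    have i3 : Integrable (fun x ↦ (r s - r t) * (2 * max (r t - ψ x) 0)) (ν s : Measure M) :=
      Continuous.integrable_of_compactSpace (by fun_prop) _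
    have i4 : Integrable (fun x ↦ (max (r s - ψ x) 0) ^ 2 - (max (r t - ψ x) 0) ^ 2)
      (ν s : Measure M) := i1.sub i2
    simp only [Pi.add_apply]
    rw [integral_sub i4 i3, integral_sub i1 i2, integral_const_mul]
    simp only [hJ, hr]
    ring
  · intro t ht
    have hJ0 : Integrable (fun x ↦ 2 * max (r t - ψ x) 0) (ν t : Measure M) :=
      Continuous.integrable_of_compactSpace (by fun_prop) _
    -- After multiplication by γ, this loss is at most the gain 2Λγ·`J t t` from the growth of `r`.
    have h1 : |∫ x, inner ℝ (riemannianGrad d (fun x ↦ (max (r t - ψ x) 0) ^ 2) x)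
        (riemannianGrad d (W t) x) ∂(ν t : Measure M)| ≤ 2 * Λ * J t t := by
      rw [hJ, ← integral_const_mul, ← Real.norm_eq_abs]
      refine norm_integral_le_of_norm_le (hJ0.const_mul _) (Eventually.of_forall fun x ↦ ?_)
      have hh : HasDerivAt (fun u : ℝ ↦ (max (r t - u) 0) ^ 2) (-(2 * max (r t - ψ x) 0)) (ψ x) := by
        have := (hasDerivAt_max_zero_sq (r t - ψ x)).comp (ψ x)
          ((hasDerivAt_id (ψ x)).const_sub (r t))
        exact this.congr_deriv (by simp)
      rw [inner_riemannianGrad_comp hh (hψs.mdifferentiableAt one_ne_zero), norm_mul, norm_neg,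
        Real.norm_of_nonneg (by positivity), mul_comm]
      refine mul_le_mul_of_nonneg_right ?_ (by positivity)
      exact (norm_inner_le_norm _ _).trans
        (mul_le_mul (hψg x) ((hW t).norm_riemannianGrad_le x) (norm_nonneg _) zero_le_two)
    have h2 : ∫ x, (max (r t - ψ x) 0) ^ 2 * (W t x - c t) ∂(ν t : Measure M) ≤
        (W t p + Λ * ρ - c t) * ∫ x, (max (r t - ψ x) 0) ^ 2 ∂(ν t : Measure M) := by
      rw [← integral_const_mul]
      refine integral_mono (Continuous.integrable_of_compactSpace (by fun_prop) _)
        (Continuous.integrable_of_compactSpace (by fun_prop) _) fun x ↦ ?_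
      dsimp only
      rw [mul_comm]
      rcases le_or_gt (r t) (ψ x) with hx | hx
      · simp [max_eq_right (sub_nonpos.2 hx)]
      refine mul_le_mul_of_nonneg_right ?_ (by positivity)
      have h3 : f x < ρ := by
        have := hψf x
        rw [abs_le] at this
        have := hrT t ht
        linarith
      have h4 : edist p x < ENNReal.ofReal ρ := by
        by_contra! h
        simp only [hf, min_eq_right h, ENNReal.toReal_ofReal hρ0.le, lt_irrefl] at h3
      have h5 : edist (W t x) (W t p) ≤ ENNReal.ofReal (Λ * ρ) := by
        rw [ENNReal.ofReal_mul hΛ, ENNReal.ofReal_coe_nnreal]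
        refine (hW t x p).trans ?_
        rw [edist_comm x p]
        gcongr
      rw [edist_dist, ENNReal.ofReal_le_ofReal_iff (by positivity), Real.dist_eq, abs_le] at h5
      linarith
    have h6 := mul_le_mul_of_nonneg_left h2 hα
    have h7 := mul_le_mul_of_nonneg_left ((le_abs_self _).trans h1) hγ
    simp only [neg_mul]
    linarith
  · exact fun t ↦ integral_nonneg fun x ↦ by positivity
  · have hb : ∀ x, max (r T - ψ x) 0 ≤ ρ := fun x ↦ by
      refine max_le ?_ hρ0.le
      have h1 := hψf x
      have h2 : 0 ≤ f x := ENNReal.toReal_nonneg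
      have h3 := hrT T (right_mem_Icc.2 hT)
      rw [abs_le] at h1
      linarith
    calc _ ≤ ∫ _x, ρ ^ 2 ∂(ν T : Measure M) := by
          refine integral_mono ((hφs T).continuous.integrable_of_compactSpace _)
            (integrable_const _) fun x ↦ ?_
          exact pow_le_pow_left₀ (le_max_right _ _) (hb x) 2
      _ = ρ ^ 2 := by simp
  · have hmeas : MeasurableSet (Metric.eball p (ENNReal.ofReal η)) :=
      Metric.isOpen_eball.measurableSet
    calc _ = ∫ x, (Metric.eball p (ENNReal.ofReal η)).indicator (fun _ ↦ η ^ 2) x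
          ∂(ν 0 : Measure M) := by
          rw [integral_indicator_const _ hmeas, smul_eq_mul, mul_comm]
      _ ≤ _ := by
          refine integral_mono ((integrable_const _).indicator hmeas)
            ((hφs 0).continuous.integrable_of_compactSpace _) fun x ↦ ?_
          by_cases hx : x ∈ Metric.eball p (ENNReal.ofReal η)
          swap
          · simp only [indicator_of_notMem hx]
            positivity
          simp only [indicator_of_mem hx]
          refine pow_le_pow_left₀ hη.le (le_max_of_le_left ?_) 2
          have h1 := hψf x
          have h2 : f x ≤ η := by
            refine ENNReal.toReal_le_of_le_ofReal hη.le ((min_le_left _ _).trans ?_)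
            rw [edist_comm]
            exact hx.le
          rw [abs_le] at h1
          simp only [hr]
          linarith

end Evolution

/-! ### Initial mass of small balls. -/

section Density

theorem DensityLowerBound.exp_mul_pow_le {d : ℕ} {M : Type*} [EMetricSpace M] [MeasurableSpace M]
    [BorelSpace M] {ν : Measure M} [IsProbabilityMeasure ν] {K K' : ℝ}
    (hν : DensityLowerBound d ν K') (hK : IsBallVolumeConst d M K) (p : M) {η : ℝ} (hη : 0 < η)
    (hη1 : η ≤ 1) :
    Real.exp (-(K + K')) * η ^ d ≤ ν.real (Metric.eball p (ENNReal.ofReal η)) := by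
  set A := Metric.eball p (ENNReal.ofReal η)
  have hA : MeasurableSet A := Metric.isOpen_eball.measurableSet
  have h1 : ENNReal.ofReal (Real.exp (-K')) * ENNReal.ofReal (Real.exp (-K) * η ^ d) ≤ ν A := by
    calc _ ≤ ENNReal.ofReal (Real.exp (-K')) * riemannianVolume d M A := by
          gcongr
          exact hK p η hη hη1
      _ = ∫⁻ _ in A, ENNReal.ofReal (Real.exp (-K')) ∂(riemannianVolume d M) := by simp
      _ ≤ ∫⁻ x in A, ν.rnDeriv (riemannianVolume d M) x ∂(riemannianVolume d M) :=
          lintegral_mono_ae (ae_restrict_of_ae hν.2)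
      _ = (riemannianVolume d M).withDensity (ν.rnDeriv (riemannianVolume d M)) A :=
          (withDensity_apply _ hA).symm
      _ ≤ ν A := Measure.withDensity_rnDeriv_le _ _ A
  rw [← ENNReal.ofReal_mul (Real.exp_pos _).le, ← mul_assoc, ← Real.exp_add] at h1
  rw [Measure.real, ← ENNReal.ofReal_le_iff_le_toReal (measure_ne_top _ _)]
  convert h1 using 4
  ring

end Density

/-! ### The loss, its first variations and the Nikaido–Isoda error. -/

section Loss

variable {X Y : Type*} [EMetricSpace X] [EMetricSpace Y] {ℓ : X → Y → ℝ}

/-- A constant strictly above the infimum makes it unnecessary to know that the infimum is attained.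
-/
theorem edist_le_of_lossLip_lt {Λ : ℝ≥0}
    (hℓ : ∃ K, LipschitzWith K (fun p : X × Y ↦ ℓ p.1 p.2)) (hΛ : lossLip ℓ < Λ) (x x' : X)
    (y y' : Y) : edist (ℓ x y) (ℓ x' y') ≤ Λ * (edist x x' + edist y y') := by
  have hne : {Λ : ℝ≥0 | ∀ x x' y y',
      edist (ℓ x y) (ℓ x' y') ≤ Λ * (edist x x' + edist y y')}.Nonempty := by
    obtain ⟨K, hK⟩ := hℓ
    refine ⟨K, fun x x' y y' ↦ (hK (x, y) (x', y')).trans ?_⟩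
    gcongr
    exact max_le le_self_add le_add_self
  obtain ⟨Λ', hΛ', hlt⟩ := exists_lt_of_csInf_lt hne hΛ
  refine (hΛ' x x' y y').trans ?_
  gcongr

theorem lossLip_le_lossConst [CompactSpace X] [CompactSpace Y] [Nonempty X] [Nonempty Y]
    (hℓ : Continuous (fun p : X × Y ↦ ℓ p.1 p.2)) : (lossLip ℓ : ℝ) ≤ lossConst ℓ := by
  have h := ciInf_le_ciSup (isCompact_range hℓ).bddBelow (isCompact_range hℓ).bddAbove
  rw [lossConst]
  linarith

variable [MeasurableSpace X] [BorelSpace X] [MeasurableSpace Y] [BorelSpace Y]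

theorem LipschitzWith.integral_right [CompactSpace Y] {Λ : ℝ≥0} (hΛ : Λ ≠ 0)
    (hc : ∀ x, Continuous (ℓ x)) (hℓ : ∀ x x' y, edist (ℓ x y) (ℓ x' y) ≤ Λ * edist x x')
    (ν : Measure Y) [IsProbabilityMeasure ν] : LipschitzWith Λ fun x ↦ ∫ y, ℓ x y ∂ν := by
  intro x x'
  rcases eq_or_ne (edist x x') ⊤ with h | h
  -- Here `Λ ≠ 0` matters: at infinite distance 0 · ⊤ would be 0.
  · simp [h, ENNReal.mul_top, hΛ]
  have hfin : (Λ : ℝ≥0∞) * edist x x' ≠ ⊤ := ENNReal.mul_ne_top ENNReal.coe_ne_top h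
  rw [edist_dist, ENNReal.ofReal_le_iff_le_toReal hfin, dist_eq_norm, ← integral_sub
    ((hc x).integrable_of_compactSpace _) ((hc x').integrable_of_compactSpace _)]
  refine (norm_integral_le_of_norm_le_const (C := ((Λ : ℝ≥0∞) * edist x x').toReal)
    (Eventually.of_forall fun y ↦ ?_)).trans (by simp)
  rw [← dist_eq_norm, ← ENNReal.ofReal_le_iff_le_toReal hfin, ← edist_dist]
  exact hℓ x x' y

/-- The loss is affine in each measure, so a bound against pure strategies integrates to one against
mixed strategies. -/
theorem nikaidoIsoda_le [CompactSpace X] [CompactSpace Y] {μ : Measure X} {ν : Measure Y}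
    [IsProbabilityMeasure μ] [IsProbabilityMeasure ν] (hℓ : Continuous (fun p : X × Y ↦ ℓ p.1 p.2))
    (hx : Continuous (firstVarX ℓ ν)) (hy : Continuous (firstVarY ℓ μ)) {b : ℝ}
    (h : ∀ p q, firstVarY ℓ μ q - firstVarX ℓ ν p ≤ b) : nikaidoIsoda ℓ μ ν ≤ b := by
  have : SecondCountableTopology X := EMetric.secondCountable_of_sigmaCompact X
  have : SecondCountableTopology Y := EMetric.secondCountable_of_sigmaCompact Y
  have : Nonempty (ProbabilityMeasure X) := ⟨⟨μ, inferInstance⟩⟩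
  have : Nonempty (ProbabilityMeasure Y) := ⟨⟨ν, inferInstance⟩⟩
  rw [nikaidoIsoda, sub_le_iff_le_add]
  refine ciSup_le fun ν' ↦ ?_
  rw [← sub_le_iff_le_add']
  refine le_ciInf fun μ' ↦ ?_
  have e : expectedLoss ℓ μ (ν' : Measure Y) = ∫ y, firstVarY ℓ μ y ∂(ν' : Measure Y) :=
    integral_integral_swap (hℓ.integrable_of_compactSpace _)
  have h1 : ∀ p, expectedLoss ℓ μ (ν' : Measure Y) ≤ b + firstVarX ℓ ν p := fun p ↦ by
    rw [e]
    calc _ ≤ ∫ _y, (b + firstVarX ℓ ν p) ∂(ν' : Measure Y) := by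
          refine integral_mono (hy.integrable_of_compactSpace _) (integrable_const _) fun q ↦ ?_
          have := h p q
          dsimp only
          linarith
      _ = _ := by simp
  calc _ = ∫ _x, (expectedLoss ℓ μ (ν' : Measure Y) - b) ∂(μ' : Measure X) := by simp
    _ ≤ ∫ x, firstVarX ℓ ν x ∂(μ' : Measure X) := by
        refine integral_mono (integrable_const _) (hx.integrable_of_compactSpace _) fun p ↦ ?_
        have := h1 p
        dsimp only
        linarith
    _ = _ := rfl

end Loss

/-! ### Regret along the flow. -/

section Flow

variable {dx dy : ℕ} {X Y : Type*} [EMetricSpace X] [CompactSpace X]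
  [ChartedSpace (EuclideanSpace ℝ (Fin dx)) X] [IsManifold (𝓡 dx) ∞ X]
  [RiemannianBundle (fun x : X ↦ TangentSpace (𝓡 dx) x)]
  [IsContinuousRiemannianBundle (EuclideanSpace ℝ (Fin dx)) (fun x : X ↦ TangentSpace (𝓡 dx) x)]
  [IsRiemannianManifold (𝓡 dx) X] [MeasurableSpace X] [BorelSpace X]
  [EMetricSpace Y] [CompactSpace Y]
  [ChartedSpace (EuclideanSpace ℝ (Fin dy)) Y] [IsManifold (𝓡 dy) ∞ Y]
  [RiemannianBundle (fun y : Y ↦ TangentSpace (𝓡 dy) y)]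
  [IsContinuousRiemannianBundle (EuclideanSpace ℝ (Fin dy)) (fun y : Y ↦ TangentSpace (𝓡 dy) y)]
  [IsRiemannianManifold (𝓡 dy) Y] [MeasurableSpace Y] [BorelSpace Y]
  {α γ : ℝ} {ℓ : X → Y → ℝ} {νx : ℝ → ProbabilityMeasure X} {νy : ℝ → ProbabilityMeasure Y}

theorem IsWFRFlow.continuousOn_integral_x (h : IsWFRFlow dx dy α γ ℓ νx νy) {f : X → ℝ}
    (hf : Continuous f) : ContinuousOn (fun s ↦ ∫ x, f x ∂(νx s : Measure X)) (Ici 0) :=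
  continuousOn_integral_of_contMDiff (d := dx)
    (fun φ hφ t ht ↦ (h.eq_x φ hφ t ht).continuousWithinAt) hf

theorem IsWFRFlow.continuousOn_integral_y (h : IsWFRFlow dx dy α γ ℓ νx νy) {f : Y → ℝ}
    (hf : Continuous f) : ContinuousOn (fun s ↦ ∫ y, f y ∂(νy s : Measure Y)) (Ici 0) :=
  continuousOn_integral_of_contMDiff (d := dy)
    (fun φ hφ t ht ↦ (h.eq_y φ hφ t ht).continuousWithinAt) hf

theorem riemannianGrad_neg (f : Y → ℝ) (y : Y) :
    riemannianGrad dy (fun y ↦ -f y) y = -riemannianGrad dy f y := by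
  refine ext_inner_right ℝ fun v ↦ ?_
  rw [inner_neg_left, inner_riemannianGrad, inner_riemannianGrad]
  have h : mfderiv (𝓡 dy) 𝓘(ℝ, ℝ) (fun y ↦ -f y) y = -mfderiv (𝓡 dy) 𝓘(ℝ, ℝ) f y :=
    mfderiv_neg
  exact congr($h v)

/-- The two players' time-integrated regrets against a pair of pure strategies. -/
theorem IsWFRFlow.integral_regret_le (h : IsWFRFlow dx dy α γ ℓ νx νy) (hα : 0 ≤ α) (hγ : 0 ≤ γ)
    (hc : Continuous (fun p : X × Y ↦ ℓ p.1 p.2)) {Λ : ℝ≥0} (hΛ : Λ ≠ 0)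
    (hℓ : ∀ x x' y y', edist (ℓ x y) (ℓ x' y') ≤ Λ * (edist x x' + edist y y'))
    {Kx Ky Kx' Ky' : ℝ} (hKx : IsBallVolumeConst dx X Kx) (hKy : IsBallVolumeConst dy Y Ky)
    (hKx' : DensityLowerBound dx (νx 0 : Measure X) Kx')
    (hKy' : DensityLowerBound dy (νy 0 : Measure Y) Ky')
    (p : X) (q : Y) {η T ρ : ℝ} (hη : 0 < η) (hη1 : η ≤ 1) (hT : 0 ≤ T)
    (hρ : ρ = 4 * η + 2 * Λ * γ * T) :
    α * (∫ s in Ioc 0 T, firstVarY ℓ (νx s : Measure X) q) -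
      α * (∫ s in Ioc 0 T, firstVarX ℓ (νy s : Measure Y) p) ≤
      4 * Real.log (ρ / η) + (Kx + Kx' + Ky + Ky') + (dx + dy) * Real.log η⁻¹ +
        2 * α * Λ * ρ * T := by
  have hcx : ∀ y, Continuous fun x ↦ ℓ x y := fun y ↦ hc.comp (by fun_prop : Continuous fun x ↦ (x, y))
  have hcy : ∀ x, Continuous (ℓ x) := fun x ↦ hc.comp (by fun_prop : Continuous fun y ↦ (x, y))
  have hVx : ∀ t, LipschitzWith Λ (firstVarX ℓ (νy t : Measure Y)) := fun t ↦
    LipschitzWith.integral_right hΛ hcy (fun x x' y ↦ by simpa using hℓ x x' y y) _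
  have hVy : ∀ t, LipschitzWith Λ fun y ↦ -firstVarY ℓ (νx t : Measure X) y := fun t ↦ by
    have := LipschitzWith.integral_right (ℓ := fun y x ↦ ℓ x y) hΛ hcx
      (fun y y' x ↦ by simpa using hℓ x x y y') (νx t : Measure X)
    exact this.neg
  obtain ⟨mx, mx', hmx, hmx', hmx0, hmxT, hmxi⟩ := exists_localized_mass (d := dx) hα hγ hVx
    (c := fun t ↦ expectedLoss ℓ (νx t : Measure X) (νy t : Measure Y)) h.eq_x p hη hT hρ
  -- The ascending player is a descending one for the potential -V_y and the value -L.
  obtain ⟨my, my', hmy, hmy', hmy0, hmyT, hmyi⟩ := exists_localized_mass (d := dy) hα hγ hVy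
    (c := fun t ↦ -expectedLoss ℓ (νx t : Measure X) (νy t : Measure Y)) (fun φ hφ t ht ↦ by
      refine (h.eq_y φ hφ t ht).congr_deriv ?_
      simp only [riemannianGrad_neg, inner_neg_right, integral_neg]
      have e : ∀ y, φ y * (-firstVarY ℓ (νx t : Measure X) y -
          -expectedLoss ℓ (νx t : Measure X) (νy t : Measure Y)) =
          -(φ y * (firstVarY ℓ (νx t : Measure X) y -
            expectedLoss ℓ (νx t : Measure X) (νy t : Measure Y))) := fun y ↦ by ring
      simp only [e, integral_neg]
      ring) q hη hT hρ
  set a : ℝ → ℝ := fun t ↦ (α * firstVarY ℓ (νx t : Measure X) q -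
    α * firstVarX ℓ (νy t : Measure Y) p) - 2 * α * Λ * ρ with ha
  have hcY : ContinuousOn (fun s ↦ firstVarY ℓ (νx s : Measure X) q) (Icc 0 T) :=
    (h.continuousOn_integral_x (hcx q)).mono Icc_subset_Ici_self
  have hcX : ContinuousOn (fun s ↦ firstVarX ℓ (νy s : Measure Y) p) (Icc 0 T) :=
    (h.continuousOn_integral_y (hcy p)).mono Icc_subset_Ici_self
  have hac : ContinuousOn a (Icc 0 T) := by fun_prop
  -- The rates of the two factors add up, and the opposite values L and -L cancel.
  have key := mul_exp_integral_le_of_mul_le_deriv hT (m := fun t ↦ mx t * my t)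
    (fun t ht ↦ (hmx t ht).mul (hmy t ht)) hac (fun t ht ↦ by
      have h1 := mul_le_mul_of_nonneg_right (hmx' t ht) (hmy0 t)
      have h2 := mul_le_mul_of_nonneg_left (hmy' t ht) (hmx0 t)
      simp only [ha]
      linarith)
  have hint : ∫ t in Ioc 0 T, a t = α * (∫ s in Ioc 0 T, firstVarY ℓ (νx s : Measure X) q) -
      α * (∫ s in Ioc 0 T, firstVarX ℓ (νy s : Measure Y) p) - 2 * α * Λ * ρ * T := by
    have iY := (hcY.integrableOn_Icc (μ := volume)).mono_set Ioc_subset_Icc_self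
    have iX := (hcX.integrableOn_Icc (μ := volume)).mono_set Ioc_subset_Icc_self
    have i1 : IntegrableOn (fun t ↦ α * firstVarY ℓ (νx t : Measure X) q -
        α * firstVarX ℓ (νy t : Measure Y) p) (Ioc 0 T) := (iY.const_mul α).sub (iX.const_mul α)
    simp only [ha]
    rw [integral_sub i1 (integrableOn_const (by simp)),
      integral_sub (iY.const_mul α) (iX.const_mul α), integral_const_mul, integral_const_mul]
    simp [Measure.real, hT]
    ring
  have hρ0 : 0 < ρ := by
    have : 0 ≤ 2 * Λ * γ * T := by positivity
    linarith
  have hx0 := (mul_le_mul_of_nonneg_left (hKx'.exp_mul_pow_le hKx p hη hη1) (sq_nonneg η)).trans hmxi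
  have hy0 := (mul_le_mul_of_nonneg_left (hKy'.exp_mul_pow_le hKy q hη hη1) (sq_nonneg η)).trans hmyi
  have hfin : η ^ 2 * (Real.exp (-(Kx + Kx')) * η ^ dx) *
      (η ^ 2 * (Real.exp (-(Ky + Ky')) * η ^ dy)) * Real.exp (∫ t in Ioc 0 T, a t) ≤
      ρ ^ 2 * ρ ^ 2 :=
    (mul_le_mul_of_nonneg_right (mul_le_mul hx0 hy0 (by positivity) (hmx0 0))
      (Real.exp_pos _).le).trans (key.trans (mul_le_mul hmxT hmyT (hmy0 T) (by positivity)))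
  -- The fourth powers of ρ and η give 4 log(ρ/η); the remaining η^(dx+dy) gives the dimensional
  -- term.
  have hlog := Real.log_le_log (by positivity) hfin
  have e1 : η ^ 2 * (Real.exp (-(Kx + Kx')) * η ^ dx) *
      (η ^ 2 * (Real.exp (-(Ky + Ky')) * η ^ dy)) * Real.exp (∫ t in Ioc 0 T, a t) =
      η ^ (4 + dx + dy) * Real.exp (-(Kx + Kx') + -(Ky + Ky') + ∫ t in Ioc 0 T, a t) := by
    rw [Real.exp_add, Real.exp_add, pow_add, pow_add]
    ring
  have e2 : ρ ^ 2 * ρ ^ 2 = ρ ^ 4 := by ring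
  rw [e1, e2, Real.log_mul (by positivity) (Real.exp_pos _).ne', Real.log_exp, Real.log_pow,
    Real.log_pow, hint] at hlog
  rw [Real.log_div hρ0.ne' hη.ne', Real.log_inv]
  push_cast at hlog
  linarith

end Flow

theorem isContinuousRiemannianBundle_of_isContMDiffRiemannianBundle (d : ℕ) (M : Type*)
    [TopologicalSpace M] [ChartedSpace (EuclideanSpace ℝ (Fin d)) M] [IsManifold (𝓡 d) 1 M]
    [RiemannianBundle (fun x : M ↦ TangentSpace (𝓡 d) x)]
    [h : IsContMDiffRiemannianBundle (𝓡 d) ∞ (EuclideanSpace ℝ (Fin d))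
      (fun x : M ↦ TangentSpace (𝓡 d) x)] :
    IsContinuousRiemannianBundle (EuclideanSpace ℝ (Fin d)) (fun x : M ↦ TangentSpace (𝓡 d) x) := by
  obtain ⟨g, hg, h⟩ := h.exists_contMDiff
  exact ⟨g, hg.continuous, h⟩

/-! ### Choice of the scale and of the time. -/

section Main

variable {dx dy : ℕ} {X Y : Type*} [EMetricSpace X] [CompactSpace X]
  [ChartedSpace (EuclideanSpace ℝ (Fin dx)) X] [IsManifold (𝓡 dx) ∞ X]
  [RiemannianBundle (fun x : X ↦ TangentSpace (𝓡 dx) x)]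
  [IsContinuousRiemannianBundle (EuclideanSpace ℝ (Fin dx)) (fun x : X ↦ TangentSpace (𝓡 dx) x)]
  [IsRiemannianManifold (𝓡 dx) X] [MeasurableSpace X] [BorelSpace X]
  [EMetricSpace Y] [CompactSpace Y]
  [ChartedSpace (EuclideanSpace ℝ (Fin dy)) Y] [IsManifold (𝓡 dy) ∞ Y]
  [RiemannianBundle (fun y : Y ↦ TangentSpace (𝓡 dy) y)]
  [IsContinuousRiemannianBundle (EuclideanSpace ℝ (Fin dy)) (fun y : Y ↦ TangentSpace (𝓡 dy) y)]
  [IsRiemannianManifold (𝓡 dy) Y] [MeasurableSpace Y] [BorelSpace Y]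
  {α γ : ℝ} {ℓ : X → Y → ℝ} {νx : ℝ → ProbabilityMeasure X} {νy : ℝ → ProbabilityMeasure Y}

/-- The Nikaido–Isoda error of the averaged flow at the time `(α η)⁻¹`, where `η² = γ / α`. -/
theorem IsWFRFlow.nikaidoIsoda_timeAverage_le (h : IsWFRFlow dx dy α γ ℓ νx νy) (hα : 0 < α)
    (hc : Continuous (fun p : X × Y ↦ ℓ p.1 p.2)) {Λ : ℝ≥0} (hΛ : Λ ≠ 0)
    (hℓ : ∀ x x' y y', edist (ℓ x y) (ℓ x' y') ≤ Λ * (edist x x' + edist y y'))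
    {Kx Ky Kx' Ky' : ℝ} (hKx : IsBallVolumeConst dx X Kx) (hKy : IsBallVolumeConst dy Y Ky)
    (hKx' : DensityLowerBound dx (νx 0 : Measure X) Kx')
    (hKy' : DensityLowerBound dy (νy 0 : Measure Y) Ky')
    {η : ℝ} (hη : 0 < η) (hη1 : η ≤ 1) (hγ : γ = α * η ^ 2) :
    nikaidoIsoda ℓ (timeAverage νx (α * η)⁻¹) (timeAverage νy (α * η)⁻¹) ≤
      η * (4 * Real.log (4 + 2 * Λ) + (Kx + Kx' + Ky + Ky') + (dx + dy) * Real.log η⁻¹ +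
        2 * Λ * (4 + 2 * Λ)) := by
  set T := (α * η)⁻¹ with hT
  have hT0 : 0 < T := by positivity
  have hix := fun f hf ↦ h.continuousOn_integral_x (f := f) hf
  have hiy := fun f hf ↦ h.continuousOn_integral_y (f := f) hf
  have := isProbabilityMeasure_timeAverage hT0 (ContinuousOn.aemeasurable_probabilityMeasure hix T)
  have := isProbabilityMeasure_timeAverage hT0 (ContinuousOn.aemeasurable_probabilityMeasure hiy T)
  have hcx : ∀ y, Continuous fun x ↦ ℓ x y := fun y ↦
    hc.comp (by fun_prop : Continuous fun x ↦ (x, y))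
  have hcy : ∀ x, Continuous (ℓ x) := fun x ↦ hc.comp (by fun_prop : Continuous fun y ↦ (x, y))
  refine nikaidoIsoda_le hc
    (LipschitzWith.integral_right hΛ hcy (fun x x' y ↦ by simpa using hℓ x x' y y) _).continuous
    (LipschitzWith.integral_right (ℓ := fun y x ↦ ℓ x y) hΛ hcx
      (fun y y' x ↦ by simpa using hℓ x x y y') _).continuous fun p q ↦ ?_
  -- Here γT = η, so ρ is proportional to η; αρT is then bounded, and the averaging factor 1/(αT)
  -- equals η.
  have key := h.integral_regret_le hα.le (by rw [hγ]; positivity) hc hΛ hℓ hKx hKy hKx' hKy' p q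
    (ρ := η * (4 + 2 * Λ)) hη hη1 hT0.le (by rw [hγ, hT]; field_simp)
  have e1 : η * (4 + 2 * Λ) / η = 4 + 2 * Λ := by field_simp
  have e2 : 2 * α * Λ * (η * (4 + 2 * Λ)) * T = 2 * Λ * (4 + 2 * Λ) := by
    rw [hT]
    field_simp
  rw [e1, e2] at key
  have hY : firstVarY ℓ (timeAverage νx T) q =
      T⁻¹ * ∫ s in Ioc 0 T, firstVarY ℓ (νx s : Measure X) q :=
    integral_timeAverage hix hT0 (hcx q)
  have hX : firstVarX ℓ (timeAverage νy T) p =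
      T⁻¹ * ∫ s in Ioc 0 T, firstVarX ℓ (νy s : Measure Y) p :=
    integral_timeAverage hiy hT0 (hcy p)
  rw [hY, hX]
  refine le_trans (le_of_eq ?_) (mul_le_mul_of_nonneg_left key hη.le)
  rw [hT, inv_inv]
  ring

end Main

/-! ### The explicit constant and the conclusion. -/

/-- The rate constant of the convergence of the averaged flow. -/
def flowConst (δ : ℝ) (dx dy : ℕ) (Kx Ky Kx' Ky' B : ℝ) : ℝ :=
  1 + |Kx| + |Ky| + |Kx'| + |Ky'| + 4 * Real.log (6 + 2 * |B|) + (dx + dy) / |δ| +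
    2 * (|B| + 1) * (6 + 2 * |B|)

theorem flowConst_pos (δ : ℝ) (dx dy : ℕ) (Kx Ky Kx' Ky' B : ℝ) :
    0 < flowConst δ dx dy Kx Ky Kx' Ky' B := by
  have : 0 ≤ Real.log (6 + 2 * |B|) := Real.log_nonneg (by linarith [abs_nonneg B])
  rw [flowConst]
  positivity

/-- The logarithm is absorbed by log(1/η) ≤ η^{-δ}/δ and the other terms by η ≤ η^{1-δ}. The bound Λ
≤ B + 1 turns 4 + 2Λ into 6 + 2|B|. -/
theorem mul_add_log_inv_le_flowConst {δ : ℝ} (hδ : 0 < δ) (dx dy : ℕ) (Kx Ky Kx' Ky' : ℝ) {B Λ η : ℝ}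
    (hΛ : 0 ≤ Λ) (hΛB : Λ ≤ B + 1) (hη : 0 < η) (hη1 : η ≤ 1) :
    η * (4 * Real.log (4 + 2 * Λ) + (Kx + Kx' + Ky + Ky') + (dx + dy) * Real.log η⁻¹ +
        2 * Λ * (4 + 2 * Λ)) ≤ flowConst δ dx dy Kx Ky Kx' Ky' B * η ^ (1 - δ) := by
  have hpow : η ≤ η ^ (1 - δ) := by
    simpa using Real.rpow_le_rpow_of_exponent_ge hη hη1 (by linarith : 1 - δ ≤ 1)
  have hlog : η * Real.log η⁻¹ ≤ η ^ (1 - δ) / δ := by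
    refine (mul_le_mul_of_nonneg_left (Real.log_le_rpow_div (by positivity) hδ) hη.le).trans_eq ?_
    rw [Real.inv_rpow hη.le, Real.rpow_sub hη, Real.rpow_one]
    field_simp
  have hB := le_abs_self B
  have h1 : Real.log (4 + 2 * Λ) ≤ Real.log (6 + 2 * |B|) :=
    Real.log_le_log (by positivity) (by linarith)
  have h0 : 0 ≤ Real.log (6 + 2 * |B|) := Real.log_nonneg (by linarith [abs_nonneg B])
  have h2 : 2 * Λ * (4 + 2 * Λ) ≤ 2 * (|B| + 1) * (6 + 2 * |B|) := by
    have h3 : Λ ≤ |B| + 1 := hΛB.trans (by linarith)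
    have h4 : 4 + 2 * Λ ≤ 6 + 2 * |B| := by linarith
    gcongr
  set S := 1 + |Kx| + |Ky| + |Kx'| + |Ky'| + 4 * Real.log (6 + 2 * |B|) +
    2 * (|B| + 1) * (6 + 2 * |B|) with hS
  have hS0 : 0 ≤ S := by positivity
  have h3 : 4 * Real.log (4 + 2 * Λ) + (Kx + Kx' + Ky + Ky') + 2 * Λ * (4 + 2 * Λ) ≤ S := by
    linarith [le_abs_self Kx, le_abs_self Ky, le_abs_self Kx', le_abs_self Ky']
  calc _ = η * (4 * Real.log (4 + 2 * Λ) + (Kx + Kx' + Ky + Ky') + 2 * Λ * (4 + 2 * Λ)) +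
        (dx + dy) * (η * Real.log η⁻¹) := by ring
    _ ≤ η ^ (1 - δ) * S + (dx + dy) * (η ^ (1 - δ) / δ) := by
        refine add_le_add ?_ (by gcongr)
        exact (mul_le_mul_of_nonneg_left h3 hη.le).trans (mul_le_mul_of_nonneg_right hpow hS0)
    _ = _ := by
        rw [flowConst, abs_of_pos hδ, hS]
        ring

end

theorem theorem2 :
    ∃ C : (δ : ℝ) → (dx dy : ℕ) → (Kx Ky Kx' Ky' B : ℝ) → ℝ,
      (∀ δ dx dy Kx Ky Kx' Ky' B, 0 < C δ dx dy Kx Ky Kx' Ky' B) ∧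
      ∀ (dx dy : ℕ)
        (X : Type*) [EMetricSpace X] [CompactSpace X]
        [ChartedSpace (EuclideanSpace ℝ (Fin dx)) X] [IsManifold (𝓡 dx) ∞ X]
        [RiemannianBundle (fun x : X ↦ TangentSpace (𝓡 dx) x)]
        [IsContMDiffRiemannianBundle (𝓡 dx) ∞ (EuclideanSpace ℝ (Fin dx))
          (fun x : X ↦ TangentSpace (𝓡 dx) x)]
        [IsRiemannianManifold (𝓡 dx) X] [MeasurableSpace X] [BorelSpace X]
        (Y : Type*) [EMetricSpace Y] [CompactSpace Y]
        [ChartedSpace (EuclideanSpace ℝ (Fin dy)) Y] [IsManifold (𝓡 dy) ∞ Y]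
        [RiemannianBundle (fun y : Y ↦ TangentSpace (𝓡 dy) y)]
        [IsContMDiffRiemannianBundle (𝓡 dy) ∞ (EuclideanSpace ℝ (Fin dy))
          (fun y : Y ↦ TangentSpace (𝓡 dy) y)]
        [IsRiemannianManifold (𝓡 dy) Y] [MeasurableSpace Y] [BorelSpace Y],
        (∃ Kx, IsBallVolumeConst dx X Kx) ∧ (∃ Ky, IsBallVolumeConst dy Y Ky) ∧
        ∀ (Kx Ky : ℝ), IsBallVolumeConst dx X Kx → IsBallVolumeConst dy Y Ky →
        ∀ (ℓ : X → Y → ℝ),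
          ContMDiff ((𝓡 dx).prod (𝓡 dy)) 𝓘(ℝ, ℝ) 1 (fun p : X × Y ↦ ℓ p.1 p.2) →
        ∀ (Kx' Ky' δ ε α γ : ℝ), 0 < δ → δ < 1 / 2 → 0 < ε → 0 < α → 0 < γ →
        ∀ (νx : ℝ → ProbabilityMeasure X) (νy : ℝ → ProbabilityMeasure Y),
          IsWFRFlow dx dy α γ ℓ νx νy →
          DensityLowerBound dx (νx 0 : Measure X) Kx' →
          DensityLowerBound dy (νy 0 : Measure Y) Ky' →
          γ / α < 1 →
          γ / α ≤ (ε / C δ dx dy Kx Ky Kx' Ky' (lossConst ℓ)) ^ (2 / (1 - δ)) →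
          nikaidoIsoda ℓ (timeAverage νx ((α * γ) ^ (-(1 / 2) : ℝ)))
            (timeAverage νy ((α * γ) ^ (-(1 / 2) : ℝ))) ≤ ε := by

  refine ⟨flowConst, flowConst_pos, ?_⟩
  intro dx dy X _ _ _ _ _ _ _ _ _ Y _ _ _ _ _ _ _ _ _
  have : IsManifold (𝓡 dx) 1 X := IsManifold.of_le (n := ∞) (by simp)
  have : IsManifold (𝓡 dy) 1 Y := IsManifold.of_le (n := ∞) (by simp)
  have := isContinuousRiemannianBundle_of_isContMDiffRiemannianBundle dx X
  have := isContinuousRiemannianBundle_of_isContMDiffRiemannianBundle dy Y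
  refine ⟨exists_isBallVolumeConst, exists_isBallVolumeConst, ?_⟩
  intro Kx Ky hKx hKy ℓ hℓ Kx' Ky' δ ε α γ hδ hδ2 hε hα hγ νx νy h hKx' hKy' hlt hle
  have : Nonempty X := ProbabilityMeasure.nonempty (νx 0)
  have : Nonempty Y := ProbabilityMeasure.nonempty (νy 0)
  have hΛ : lossLip ℓ < lossLip ℓ + 1 := lt_add_of_pos_right _ one_pos
  have hx0 : 0 < γ / α := by positivity
  set η := √(γ / α) with hηdef
  have hη : 0 < η := Real.sqrt_pos.2 hx0
  have hη1 : η ≤ 1 := Real.sqrt_le_one.2 hlt.le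
  have hη2 : η ^ 2 = γ / α := Real.sq_sqrt hx0.le
  have hγη : γ = α * η ^ 2 := by
    rw [hη2]
    field_simp
  have hT : (α * γ) ^ (-(1 / 2) : ℝ) = (α * η)⁻¹ := by
    rw [Real.rpow_neg (by positivity), ← Real.sqrt_eq_rpow,
      show α * γ = (α * η) ^ 2 by rw [hγη]; ring, Real.sqrt_sq (by positivity)]
  have hC := flowConst_pos δ dx dy Kx Ky Kx' Ky' (lossConst ℓ)
  -- The assumption on γ/α = η² is raised to the power (1-δ)/2.
  have hpow : η ^ (1 - δ) ≤ ε / flowConst δ dx dy Kx Ky Kx' Ky' (lossConst ℓ) := by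
    have h1 := Real.rpow_le_rpow hx0.le hle (by linarith : 0 ≤ (1 - δ) / 2)
    have h2 : (1 - δ) ≠ 0 := by linarith
    rwa [← Real.rpow_mul (by positivity), show 2 / (1 - δ) * ((1 - δ) / 2) = 1 by field_simp,
      Real.rpow_one, ← hη2, ← Real.rpow_natCast, ← Real.rpow_mul hη.le,
      show ((2 : ℕ) : ℝ) * ((1 - δ) / 2) = 1 - δ by push_cast; ring] at h1
  rw [hT]
  have hc := hℓ.continuous
  -- The Lipschitz constant used is `lossLip ℓ + 1`: positive, and strictly above the infimum.
  have hΛB : ((lossLip ℓ + 1 : ℝ≥0) : ℝ) ≤ lossConst ℓ + 1 := by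
    push_cast
    linarith [lossLip_le_lossConst hc]
  calc _ ≤ _ := h.nikaidoIsoda_timeAverage_le hα hc (by positivity)
        (edist_le_of_lossLip_lt hℓ.exists_lipschitzWith_prod hΛ) hKx hKy hKx' hKy' hη hη1 hγη
    _ ≤ _ := mul_add_log_inv_le_flowConst hδ dx dy Kx Ky Kx' Ky' (NNReal.coe_nonneg _) hΛB hη hη1
    _ ≤ _ := mul_le_mul_of_nonneg_left hpow hC.le
    _ = ε := by field_simp
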